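/- Let $\mathfrak h$ be a finite-dimensional commutative Lie superalgebra over $\mathbb C$ (a super vector space with zero bracket), and let $V=V_{\bar 0}\oplus V_{\bar 1}$ be a finite-dimensional semisimple $\mathfrak h$-module whose weights, counted with multiplicity, form a basis of $\mathfrak h^*$ (so $\dim V=\dim\mathfrak h$, $\mathfrak h$ is even, and $V=\bigoplus_\omega V[\omega]$ with one-dimensional weight spaces). Conventions. $T_s(a\otimes b)=(-1)^{|a||b|}b\otimes a$ is the super twist, $\mathrm{Alt}_s(a\otimes b\otimes c)=a\otimes b\otimes c+(-1)^{|a|(|b|+|c|)}b\otimes c\otimes a+(-1)^{|c|(|a|+|b|)}c\otimes a\otimes b$, and operators on tensor powers of $V$ are identified with elements of tensor powers of $\operatorname{End}V$ by the usual sign rule, so that $T_s$ acts on $\operatorname{End}(V\otimes V)$ by conjugation. $X^{ij}$ denotes $X\in\operatorname{End}(V\otimes V)$ acting on the $i$-th and $j$-th factors of $V^{\otimes 3}$ (with $X^{13}=T_s^{23}X^{12}T_s^{23}$), and $h^{(k)}$ is replaced by the weight of the $k$-th factor: e.g. $R^{12}(\lambda-\gamma h^{(3)})(v_1\otimes v_2\otimes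 v_3)=R(\lambda-\gamma\omega)(v_1\otimes v_2)\otimes v_3$ for $v_3\in V[\omega]$. An operator $X$ on $V\otimes V$ has zero weight if $[h\otimes1+1\otimes h,X]=0$ for all $h\in\mathfrak h$. Let $U\subset\mathfrak h^*$ be an open polydisc (in some linear coordinates), and let $r:U\to\operatorname{End}(V\otimes V)$ be holomorphic and a super dynamical $r$-matrix with zero weight and zero coupling constant. That is, for all $\lambda\in U$: $r(\lambda)$ has zero weight, $r(\lambda)+T_s(r(\lambda))=0$, and $$\mathrm{Alt}_s(dr)+[r^{12},r^{13}]+[r^{12},r^{23}]+[r^{13},r^{23}]=0,\qquad dr=\sum_i x_i\otimes\frac{\partial r}{\partial x_i},$$ where $\{x_i\}$ is a basis of $\mathfrak h$, viewed as a system of linear coordinates on $\mathfrak h^*$. Then $r$ can be quantized to a super dynamical $R$-matrix on $U$: there are holomorphic functions $r_n:U\to\operatorname{End}(V\otimes V)$, $n\ge2$, such that every point of $U$ has a neighbourhood $N\subset U$ and an $\varepsilon>0$ for which, for all $\gamma\in\mathbb C$ with $|\gamma|<\varepsilon$ and all $\lambda\in N$, the series $$R_\gamma(\lambda)=1-\gamma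 r(\lambda)+\sum_{n\ge2}\gamma^n r_n(\lambda)$$ converges, $R_\gamma(\lambda)$ is invertible and has zero weight, and the quantum dynamical Yang–Baxter equation with step $\gamma$, $$R_\gamma^{12}(\lambda-\gamma h^{(3)})R_\gamma^{13}(\lambda)R_\gamma^{23}(\lambda-\gamma h^{(1)})=R_\gamma^{23}(\lambda)R_\gamma^{13}(\lambda-\gamma h^{(2)})R_\gamma^{12}(\lambda),$$ holds whenever $\lambda-\gamma\omega\in N$ for all weights $\omega$ of $V$. -/

import Mathlib

open scoped TensorProduct

namespace SuperDynamical

noncomputable section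

/-! ### Commutative Lie superalgebras and their modules

A commutative Lie superalgebra is a super vector space `𝔥 = 𝒽 0 ⊕ 𝒽 1` with zero bracket. -/

section Modules

variable {𝔥 V : Type*} [AddCommGroup 𝔥] [Module ℂ 𝔥] [AddCommGroup V] [Module ℂ V]

/-- `ρ` makes the super vector space `V = 𝒱 0 ⊕ 𝒱 1` a module over the commutative Lie
superalgebra `𝔥 = 𝒽 0 ⊕ 𝒽 1`: the action respects parities, and the supercommutator of the
actions of two homogeneous elements is the action of their bracket, which is zero. -/
structure IsModule (𝒽 : ZMod 2 → Submodule ℂ 𝔥) (𝒱 : ZMod 2 → Submodule ℂ V)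
    (ρ : 𝔥 →ₗ[ℂ] Module.End ℂ V) : Prop where
  parity : ∀ i j : ZMod 2, ∀ x ∈ 𝒽 i, ∀ v ∈ 𝒱 j, ρ x v ∈ 𝒱 (i + j)
  supercomm : ∀ i j : ZMod 2, ∀ x ∈ 𝒽 i, ∀ y ∈ 𝒽 j,
    ρ x * ρ y - (-1 : ℤˣ) ^ (i * j) • (ρ y * ρ x) = 0

/-- `W` is a sub-(super)module of `V`: it is graded and stable under `𝔥`. -/
def IsSubmodule (𝒱 : ZMod 2 → Submodule ℂ V) [DirectSum.Decomposition 𝒱]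
    (ρ : 𝔥 →ₗ[ℂ] Module.End ℂ V) (W : Submodule ℂ V) : Prop :=
  DirectSum.SetLike.IsHomogeneous 𝒱 W ∧ ∀ x : 𝔥, ∀ v ∈ W, ρ x v ∈ W

/-- Semisimplicity: every submodule has a complementary submodule. -/
def IsSemisimple (𝒱 : ZMod 2 → Submodule ℂ V) [DirectSum.Decomposition 𝒱]
    (ρ : 𝔥 →ₗ[ℂ] Module.End ℂ V) : Prop :=
  ∀ W : Submodule ℂ V, IsSubmodule 𝒱 ρ W →
    ∃ W' : Submodule ℂ V, IsSubmodule 𝒱 ρ W' ∧ IsCompl W W'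

/-- The weight space `V[ω]`. -/
def weightSpace (ρ : 𝔥 →ₗ[ℂ] Module.End ℂ V) (ω : Module.Dual ℂ 𝔥) : Submodule ℂ V :=
  ⨅ x : 𝔥, Module.End.eigenspace (ρ x) (ω x)

/-- The set of weights of `V`. -/
def weights (ρ : 𝔥 →ₗ[ℂ] Module.End ℂ V) : Set (Module.Dual ℂ 𝔥) :=
  {ω | weightSpace ρ ω ≠ ⊥}

/-- The weights of `V`, counted with multiplicity, form a basis of `𝔥*`: the set of weights is a
basis, and the number `dim V` of weights counted with multiplicity is `dim 𝔥`. -/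
structure WeightsFormBasis (ρ : 𝔥 →ₗ[ℂ] Module.End ℂ V) : Prop where
  linearIndependent : LinearIndependent ℂ (fun ω : weights ρ => (ω : Module.Dual ℂ 𝔥))
  span_eq_top : Submodule.span ℂ (weights ρ) = ⊤
  finrank_eq : Module.finrank ℂ V = Module.finrank ℂ 𝔥

end Modules

/-! ### Operators on `V ⊗ V` and `V ⊗ V ⊗ V`

`End (V ⊗ V)` is identified with the graded tensor product of algebras `End V ⊗ End V` by the
usual sign rule `(A ⊗ B)(u ⊗ v) = (-1)^(|B||u|) Au ⊗ Bv`, similarly for three factors.  Permuting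
the factors of `End V ⊗ ⋯ ⊗ End V` with signs is then conjugation by the signed permutation of
the factors of `V ⊗ ⋯ ⊗ V`. -/

section Operators

variable {V : Type*} [AddCommGroup V] [Module ℂ V]
variable (𝒱 : ZMod 2 → Submodule ℂ V) [DirectSum.Decomposition 𝒱]

/-- The super twist `a ⊗ b ↦ (-1)^(|a||b|) b ⊗ a` on `V ⊗ V`. -/
def superTwist : Module.End ℂ (V ⊗[ℂ] V) :=
  let e := TensorProduct.congr (DirectSum.decomposeLinearEquiv 𝒱)
    (DirectSum.decomposeLinearEquiv 𝒱)
  (e.trans ((TensorProduct.gradedComm ℂ (fun i => 𝒱 i) (fun i => 𝒱 i)).trans e.symm)).toLinearMap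

theorem superTwist_tmul {i j : ZMod 2} {a b : V} (ha : a ∈ 𝒱 i) (hb : b ∈ 𝒱 j) :
    superTwist 𝒱 (a ⊗ₜ b) = (-1 : ℤˣ) ^ (i * j) • (b ⊗ₜ[ℂ] a) := by
  have h1 : DirectSum.decompose 𝒱 a = DirectSum.lof ℂ _ (fun i => 𝒱 i) i ⟨a, ha⟩ :=
    DirectSum.decompose_of_mem 𝒱 ha
  have h2 : DirectSum.decompose 𝒱 b = DirectSum.lof ℂ _ (fun i => 𝒱 i) j ⟨b, hb⟩ :=
    DirectSum.decompose_of_mem 𝒱 hb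
  have h1' : (DirectSum.decomposeLinearEquiv 𝒱).symm
      (DirectSum.lof ℂ _ (fun i => 𝒱 i) i ⟨a, ha⟩) = a := by
    rw [← h1]; exact (DirectSum.decompose 𝒱).symm_apply_apply a
  have h2' : (DirectSum.decomposeLinearEquiv 𝒱).symm
      (DirectSum.lof ℂ _ (fun i => 𝒱 i) j ⟨b, hb⟩) = b := by
    rw [← h2]; exact (DirectSum.decompose 𝒱).symm_apply_apply b
  simp only [superTwist, LinearEquiv.coe_coe, LinearEquiv.trans_apply, TensorProduct.congr_tmul,
    DirectSum.decomposeLinearEquiv_apply, h1, h2]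
  rw [TensorProduct.gradedComm_of_tmul_of, Units.smul_def, map_zsmul,
    TensorProduct.congr_symm_tmul, h1', h2', Units.smul_def, mul_comm]

/-- `T^{12}`: the operator `T` acting on the first and second factors. -/
def op12 (T : Module.End ℂ (V ⊗[ℂ] V)) : Module.End ℂ (V ⊗[ℂ] (V ⊗[ℂ] V)) :=
  (TensorProduct.assoc ℂ V V V).toLinearMap ∘ₗ T.rTensor V ∘ₗ
    (TensorProduct.assoc ℂ V V V).symm.toLinearMap

/-- `T^{23}`: the operator `T` acting on the second and third factors. -/
def op23 (T : Module.End ℂ (V ⊗[ℂ] V)) : Module.End ℂ (V ⊗[ℂ] (V ⊗[ℂ] V)) :=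
  T.lTensor V

/-- `T^{13}`: the operator `T` acting on the first and third factors, i.e. `T^{12}` conjugated by
the super twist of the second and third factors. -/
def op13 (T : Module.End ℂ (V ⊗[ℂ] V)) : Module.End ℂ (V ⊗[ℂ] (V ⊗[ℂ] V)) :=
  op23 (superTwist 𝒱) * op12 T * op23 (superTwist 𝒱)

/-- `T_s` on `End V ⊗ End V = End (V ⊗ V)`: it sends `A ⊗ B` to `(-1)^(|A||B|) B ⊗ A`. -/
def twistOp (T : Module.End ℂ (V ⊗[ℂ] V)) : Module.End ℂ (V ⊗[ℂ] V) :=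
  superTwist 𝒱 * T * superTwist 𝒱

/-- The super symmetrizing map on `End V ⊗ End V ⊗ End V = End (V ⊗ V ⊗ V)`: it sends `A ⊗ B ⊗ C`
to `A ⊗ B ⊗ C + (-1)^(|A|(|B|+|C|)) B ⊗ C ⊗ A + (-1)^(|C|(|A|+|B|)) C ⊗ A ⊗ B`.  Here `c` is the
signed cyclic permutation `a ⊗ b ⊗ c ↦ (-1)^(|a|(|b|+|c|)) b ⊗ c ⊗ a`, with inverse `c'`. -/
def altOp (T : Module.End ℂ (V ⊗[ℂ] (V ⊗[ℂ] V))) : Module.End ℂ (V ⊗[ℂ] (V ⊗[ℂ] V)) :=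
  let c := op23 (superTwist 𝒱) * op12 (superTwist 𝒱)
  let c' := op12 (superTwist 𝒱) * op23 (superTwist 𝒱)
  T + c * T * c' + c' * T * c

end Operators

/-! ### Polydiscs, holomorphic functions, derivatives, power series

All vector spaces here are finite-dimensional over `ℂ`; coordinates and linear functionals are
used instead of norms. -/

section Analysis

variable {E W : Type*} [AddCommGroup E] [Module ℂ E] [AddCommGroup W] [Module ℂ W]

/-- `U` is an open polydisc with respect to some linear coordinate system on `E`. -/
def IsOpenPolydisc (U : Set E) : Prop :=
  ∃ (n : ℕ) (e : Module.Basis (Fin n) ℂ E) (c : E) (ρ : Fin n → ℝ), (∀ i, 0 < ρ i) ∧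
    U = {z | ∀ i, ‖e.repr (z - c) i‖ < ρ i}

/-- `f` is holomorphic on the open set `U`: every coordinate of `f` is a holomorphic function of
linear coordinates on `E`. -/
def IsHolomorphicOn (f : E → W) (U : Set E) : Prop :=
  ∀ (ℓ : Module.Dual ℂ W) (n : ℕ) (φ : (Fin n → ℂ) ≃ₗ[ℂ] E),
    DifferentiableOn ℂ (fun z => ℓ (f (φ z))) (φ ⁻¹' U)

/-- `D` is the derivative of `f` at `z` in the direction `ξ`. -/
def HasDirDeriv (f : E → W) (D : W) (ξ z : E) : Prop :=
  ∀ ℓ : Module.Dual ℂ W, HasDerivAt (fun t : ℂ => ℓ (f (z + t • ξ))) (ℓ D) 0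

/-- The power series `∑ γ ^ n • c n` converges to `w`. -/
def HasPowerSeriesSum (c : ℕ → W) (γ : ℂ) (w : W) : Prop :=
  ∀ ℓ : Module.Dual ℂ W, HasSum (fun n => γ ^ n * ℓ (c n)) (ℓ w)

end Analysis

/-! ### Dynamical Yang-Baxter equations -/

section YangBaxter

variable {𝔥 V : Type*} [AddCommGroup 𝔥] [Module ℂ 𝔥] [FiniteDimensional ℂ 𝔥]
  [AddCommGroup V] [Module ℂ V]
variable (𝒱 : ZMod 2 → Submodule ℂ V) [DirectSum.Decomposition 𝒱]
variable (ρ : 𝔥 →ₗ[ℂ] Module.End ℂ V)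

/-- Zero weight condition: `[h ⊗ 1 + 1 ⊗ h, T] = 0` for all `h ∈ 𝔥`.  (No sign in `1 ⊗ h`: when
the weights form a basis of `𝔥*`, all of `𝔥` is even.) -/
def HasZeroWeight (T : Module.End ℂ (V ⊗[ℂ] V)) : Prop :=
  ∀ h : 𝔥, ⁅(ρ h).rTensor V + (ρ h).lTensor V, T⁆ = 0

/-- The classical dynamical Yang-Baxter equation at the point `z`:
`Alt_s(dr) + [r^{12}, r^{13}] + [r^{12}, r^{23}] + [r^{13}, r^{23}] = 0`, with
`dr = ∑ i, x_i ⊗ ∂r/∂x_i` for a basis `x_i` of `𝔥`, viewed as coordinates on `𝔥*`.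
(`dr` does not depend on the basis; the zero weight `r` considered are even, so that the
supercommutators are commutators.) -/
def CDYBE (r : Module.Dual ℂ 𝔥 → Module.End ℂ (V ⊗[ℂ] V)) (z : Module.Dual ℂ 𝔥) : Prop :=
  let x := Module.finBasis ℂ 𝔥
  ∃ D : Fin (Module.finrank ℂ 𝔥) → Module.End ℂ (V ⊗[ℂ] V),
    (∀ i, HasDirDeriv r (D i) (x.dualBasis i) z) ∧
    altOp 𝒱 (∑ i, TensorProduct.map (ρ (x i)) (D i))
      + ⁅op12 (r z), op13 𝒱 (r z)⁆ + ⁅op12 (r z), op23 (r z)⁆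
      + ⁅op13 𝒱 (r z), op23 (r z)⁆ = 0

/-- `r` is a super dynamical `r`-matrix on `U` with zero weight and zero coupling constant. -/
structure IsZeroWeightZeroCouplingRMatrix (U : Set (Module.Dual ℂ 𝔥))
    (r : Module.Dual ℂ 𝔥 → Module.End ℂ (V ⊗[ℂ] V)) : Prop where
  cdybe : ∀ z ∈ U, CDYBE 𝒱 ρ r z
  unitarity : ∀ z ∈ U, r z + twistOp 𝒱 (r z) = 0
  zeroWeight : ∀ z ∈ U, HasZeroWeight ρ (r z)

/-- The quantum dynamical Yang-Baxter equation with step `γ` at the point `z`: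
`R^{12}(z - γ h^{(3)}) R^{13}(z) R^{23}(z - γ h^{(1)})
  = R^{23}(z) R^{13}(z - γ h^{(2)}) R^{12}(z)`.
`A`, `B`, `C` are the three operators with shifted argument, where `h^{(k)}` stands for the weight
of the `k`-th factor; as `V` is the sum of its weight spaces, they exist and are unique. -/
def QDYBE (γ : ℂ) (R : Module.Dual ℂ 𝔥 → Module.End ℂ (V ⊗[ℂ] V)) (z : Module.Dual ℂ 𝔥) : Prop :=
  ∃ A B C : Module.End ℂ (V ⊗[ℂ] (V ⊗[ℂ] V)),
    (∀ ω ∈ weights ρ, ∀ u v : V, ∀ w ∈ weightSpace ρ ω,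
      A (u ⊗ₜ (v ⊗ₜ w)) = op12 (R (z - γ • ω)) (u ⊗ₜ (v ⊗ₜ w))) ∧
    (∀ ω ∈ weights ρ, ∀ u ∈ weightSpace ρ ω, ∀ v w : V,
      B (u ⊗ₜ (v ⊗ₜ w)) = op23 (R (z - γ • ω)) (u ⊗ₜ (v ⊗ₜ w))) ∧
    (∀ ω ∈ weights ρ, ∀ u : V, ∀ v ∈ weightSpace ρ ω, ∀ w : V,
      C (u ⊗ₜ (v ⊗ₜ w)) = op13 𝒱 (R (z - γ • ω)) (u ⊗ₜ (v ⊗ₜ w))) ∧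
    A * op13 𝒱 (R z) * B = op23 (R z) * C * op12 (R z)

/-- `R` is a super dynamical `R`-matrix with step `γ` on `N`: it is invertible, of zero weight, and
satisfies the quantum dynamical Yang-Baxter equation wherever all shifted points lie in `N`. -/
structure IsSuperDynamicalRMatrixOn (γ : ℂ) (N : Set (Module.Dual ℂ 𝔥))
    (R : Module.Dual ℂ 𝔥 → Module.End ℂ (V ⊗[ℂ] V)) : Prop where
  invertible : ∀ z ∈ N, IsUnit (R z)
  zeroWeight : ∀ z ∈ N, HasZeroWeight ρ (R z)
  qdybe : ∀ z ∈ N, (∀ ω ∈ weights ρ, z - γ • ω ∈ N) → QDYBE 𝒱 ρ γ R z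

/-- `r` can be quantized to a super dynamical `R`-matrix on `U`: there is a power series
`R γ = 1 - γ r + ∑_{n ≥ 2} γ ^ n c n` with coefficients holomorphic on `U` that, locally uniformly
in `z ∈ U`, converges for small `γ` to a super dynamical `R`-matrix with step `γ`. -/
def IsQuantizableOn (U : Set (Module.Dual ℂ 𝔥))
    (r : Module.Dual ℂ 𝔥 → Module.End ℂ (V ⊗[ℂ] V)) : Prop :=
  ∃ (c : ℕ → Module.Dual ℂ 𝔥 → Module.End ℂ (V ⊗[ℂ] V))
    (R : ℂ → Module.Dual ℂ 𝔥 → Module.End ℂ (V ⊗[ℂ] V)),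
    (∀ z ∈ U, c 0 z = 1) ∧ (∀ z ∈ U, c 1 z = -r z) ∧ (∀ n, IsHolomorphicOn (c n) U) ∧
    ∀ z₀ ∈ U, ∃ N : Set (Module.Dual ℂ 𝔥), IsOpenPolydisc N ∧ z₀ ∈ N ∧ N ⊆ U ∧
      ∃ ε : ℝ, 0 < ε ∧ ∀ γ : ℂ, ‖γ‖ < ε →
        (∀ z ∈ N, HasPowerSeriesSum (fun n => c n z) γ (R γ z)) ∧
        IsSuperDynamicalRMatrixOn 𝒱 ρ γ N (R γ)

end YangBaxter

end

end SuperDynamical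

/-! In a homogeneous weight basis `v a`, with coordinates `y` on `𝔥*` in the basis of weights,
independence of the weights forces a zero weight operator to send `v_a ⊗ v_b` to a combination of
`v_a ⊗ v_b` and `v_b ⊗ v_a`. Let `r` have coefficients `A_ab` and `s_ab β_ab`, where `s_ab =
(-1)^(|a||b|)`. The classical equation then splits into scalar conditions: the 2-form `A` is closed,
`β_ab` depends only on `y_a, y_b`, `∂_a β_ab = s_aa β_ab²`, and `β_ab β_bc = β_ac (β_ab + β_bc)`.

The quantization is `R(v_a ⊗ v_b) = α_ab v_a ⊗ v_b - γ s_ab β_ab v_b ⊗ v_a`, whose flip part is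
exactly linear in `γ`. The Riccati equation integrates to `β_ab(y - γ e_a) (1 + s_aa γ β_ab(y)) =
β_ab(y)` (`riccati_shift`), so the quantum equation reduces to `α_aa = 1`, `α_ab α_ba = 1 - γ²
β_ab²` and a multiplicative cocycle condition on `α` for distinct indices
(`QuantumRelations.yangBaxter`).

The factor `1 + γ β_ab` solves these conditions, and still does after multiplication by the
exponential of a finite-difference coboundary. Since `β` does not depend on third coordinates, `A +
β` is closed, and `exists_potential` gives `ξ` with `dξ = A + β`. Using the difference analogue of
`-dξ` as exponent gives `α_ab = 1 - γ A_ab + O(γ²)`. The Taylor coefficients of `α` in `γ` are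
holomorphic in `y`, which yields the `r_n`. -/

namespace SuperDynamical

/-! ### Cauchy estimates and holomorphic dependence on parameters. -/

section Holomorphic

open Metric Set MeasureTheory

variable {E : Type*} [NormedAddCommGroup E] [NormedSpace ℂ E]

/-- The ball is mapped into the disc of radius `2 * M` about `f c`, so the Schwarz lemma applies. -/
theorem norm_fderiv_le_of_norm_le {f : E → ℂ} {c : E} {R M : ℝ} (hR : 0 < R)
    (hd : DifferentiableOn ℂ f (ball c R)) (hM : ∀ z ∈ ball c R, ‖f z‖ ≤ M) :
    ‖fderiv ℂ f c‖ ≤ 2 * M / R := by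
  refine Complex.norm_fderiv_le_div_of_mapsTo_ball hd (fun z hz => ?_) hR
  rw [mem_closedBall, dist_eq_norm]
  have h1 := hM z hz
  have h2 := hM c (mem_ball_self hR)
  linarith [norm_sub_le (f z) (f c)]

variable [ProperSpace E]

/-- On a compact neighbourhood `G · s` and `G · t` are uniformly close for close `s, t`; the Cauchy
estimate for their difference passes this on to the derivatives. -/
theorem continuousOn_fderiv_param {a b : ℝ} {Ω : Set E} (hΩ : IsOpen Ω) {G : E → ℝ → ℂ}
    (hc : ContinuousOn (fun p : E × ℝ => G p.1 p.2) (Ω ×ˢ Icc a b))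
    (hd : ∀ t ∈ Icc a b, DifferentiableOn ℂ (fun y => G y t) Ω) {y : E} (hy : y ∈ Ω) :
    ContinuousOn (fun t => fderiv ℂ (fun z => G z t) y) (Icc a b) := by
  obtain ⟨R, hR, hRΩ⟩ := nhds_basis_closedBall.mem_iff.1 (hΩ.mem_nhds hy)
  have hu := ((isCompact_closedBall y R).prod (isCompact_Icc (a := a) (b := b))
    ).uniformContinuousOn_of_continuous (hc.mono (prod_mono hRΩ le_rfl))
  rw [Metric.uniformContinuousOn_iff] at hu
  rw [Metric.continuousOn_iff]
  intro t ht ε hε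
  -- With this bound the Cauchy estimate gives `ε / 2`.
  obtain ⟨δ, hδ, H⟩ := hu (ε * R / 4) (by positivity)
  refine ⟨δ, hδ, fun s hs hst => ?_⟩
  have hball : ball y R ⊆ Ω := ball_subset_closedBall.trans hRΩ
  have hds := (hd s hs).mono hball
  have hdt := (hd t ht).mono hball
  have hn : ball y R ∈ nhds y := ball_mem_nhds y hR
  rw [dist_eq_norm, ← fderiv_fun_sub (hds.differentiableAt hn) (hdt.differentiableAt hn)]
  refine (norm_fderiv_le_of_norm_le (M := ε * R / 4) hR (hds.sub hdt) fun z hz => ?_).trans_lt ?_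
  · rw [Pi.sub_apply, ← dist_eq_norm]
    refine (H (z, s) ⟨ball_subset_closedBall hz, hs⟩ (z, t) ⟨ball_subset_closedBall hz, ht⟩ ?_).le
    simpa [Prod.dist_eq, hδ] using hst
  · rw [div_lt_iff₀ hR]; nlinarith [mul_pos hε hR]

/-- A bound for `G` on a ball becomes, by the Cauchy estimate on balls of half the radius, a
constant dominating function for the derivative. -/
theorem hasFDerivAt_intervalIntegral_of_holomorphic {a b : ℝ} (hab : a ≤ b) {Ω : Set E}
    (hΩ : IsOpen Ω) {G : E → ℝ → ℂ}
    (hc : ContinuousOn (fun p : E × ℝ => G p.1 p.2) (Ω ×ˢ Icc a b))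
    (hd : ∀ t ∈ Icc a b, DifferentiableOn ℂ (fun y => G y t) Ω) {y : E} (hy : y ∈ Ω) :
    HasFDerivAt (fun y => ∫ t in a..b, G y t)
      (∫ t in a..b, fderiv ℂ (fun z => G z t) y) y := by
  obtain ⟨R, hR, hRΩ⟩ := nhds_basis_closedBall.mem_iff.1 (hΩ.mem_nhds hy)
  obtain ⟨M, hM⟩ := ((isCompact_closedBall y R).prod (isCompact_Icc (a := a) (b := b))
    ).exists_bound_of_continuousOn (hc.mono (prod_mono hRΩ le_rfl))
  have hcG : ∀ x ∈ Ω, ContinuousOn (G x) (Icc a b) := fun x hx =>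
    hc.comp (f := fun t => (x, t)) (by fun_prop) fun t ht => ⟨hx, ht⟩
  have hsub : uIoc a b ⊆ Icc a b := by rw [uIoc_of_le hab]; exact Ioc_subset_Icc_self
  refine intervalIntegral.hasFDerivAt_integral_of_dominated_of_fderiv_le
    (F' := fun x t => fderiv ℂ (fun z => G z t) x) (bound := fun _ => 2 * M / (R / 2))
    (ball_mem_nhds y (half_pos hR)) ?_ ?_ ?_ ?_ (by simp) ?_
  · filter_upwards [hΩ.mem_nhds hy] with x hx
    exact ((hcG x hx).mono hsub).aestronglyMeasurable measurableSet_uIoc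
  · exact ContinuousOn.intervalIntegrable (by rw [uIcc_of_le hab]; exact hcG y hy)
  · exact ((continuousOn_fderiv_param hΩ hc hd hy).mono hsub).aestronglyMeasurable
      measurableSet_uIoc
  · refine Filter.Eventually.of_forall fun t ht x hx => ?_
    have hx' : ball x (R / 2) ⊆ closedBall y R := by
      refine (ball_subset_ball' (ε₂ := R) ?_).trans ball_subset_closedBall
      rw [mem_ball] at hx; linarith
    exact norm_fderiv_le_of_norm_le (half_pos hR) ((hd t (hsub ht)).mono (hx'.trans hRΩ))
      fun z hz => hM (z, t) ⟨hx' hz, hsub ht⟩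
  · refine Filter.Eventually.of_forall fun t ht x hx => ?_
    have hxΩ : x ∈ Ω := hRΩ (ball_subset_closedBall (ball_subset_ball (by linarith) hx))
    exact ((hd t (hsub ht)).differentiableAt (hΩ.mem_nhds hxΩ)).hasFDerivAt

/-- The directional derivative is a Cauchy integral over a small circle in the direction `v`, and
the integrand is holomorphic in `y`. -/
theorem differentiableOn_fderiv_apply {Ω : Set E} (hΩ : IsOpen Ω) {f : E → ℂ}
    (hf : DifferentiableOn ℂ f Ω) (v : E) :
    DifferentiableOn ℂ (fun y => fderiv ℂ f y v) Ω := by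
  intro y₀ hy₀
  obtain ⟨R, hR, hRΩ⟩ := Metric.mem_nhds_iff.1 (hΩ.mem_nhds hy₀)
  obtain ⟨κ, hκ, hκv⟩ : ∃ κ : ℝ, 0 < κ ∧ κ * ‖v‖ < R / 2 :=
    ⟨R / 2 / (‖v‖ + 1), by positivity, by
      rw [div_mul_eq_mul_div, div_lt_iff₀ (by positivity)]; nlinarith [norm_nonneg v]⟩
  have hmem : ∀ y ∈ ball y₀ (R / 2), ∀ ζ ∈ closedBall (0 : ℂ) κ, y + ζ • v ∈ Ω := by
    intro y hy ζ hζ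
    apply hRΩ
    rw [mem_ball, dist_eq_norm] at hy ⊢
    rw [mem_closedBall_zero_iff] at hζ
    have h1 : ‖ζ • v‖ ≤ κ * ‖v‖ := by rw [norm_smul]; gcongr
    calc ‖y + ζ • v - y₀‖ = ‖(y - y₀) + ζ • v‖ := by congr 1; abel
      _ ≤ _ := norm_add_le _ _
      _ < R := by linarith
  have hformula : ∀ y ∈ ball y₀ (R / 2), fderiv ℂ f y v =
      (2 * Real.pi * Complex.I : ℂ)⁻¹ • ∮ ζ in C(0, κ), (1 / (ζ - 0) ^ 2) • f (y + ζ • v) := by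
    intro y hy
    have hyΩ : y ∈ Ω := by simpa using hmem y hy 0 (by simpa using hκ.le)
    have hd : DifferentiableOn ℂ (fun ζ : ℂ => f (y + ζ • v)) (closedBall 0 κ) :=
      hf.comp (by fun_prop) fun ζ hζ => hmem y hy ζ hζ
    rw [hd.deriv_eq_smul_circleIntegral hκ, inv_smul_smul₀ Complex.two_pi_I_ne_zero]
    have h1 : HasFDerivAt f (fderiv ℂ f y) (y + (0 : ℂ) • v) := by
      simpa using (hf.differentiableAt (hΩ.mem_nhds hyΩ)).hasFDerivAt
    have h2 : HasDerivAt (fun ζ : ℂ => y + ζ • v) v 0 := by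
      simpa using ((hasDerivAt_id (0 : ℂ)).smul_const v).const_add y
    exact (h1.comp_hasDerivAt (0 : ℂ) h2).deriv.symm
  have key : DifferentiableOn ℂ (fun y => ∮ ζ in C(0, κ), (1 / (ζ - 0) ^ 2) • f (y + ζ • v))
      (ball y₀ (R / 2)) := by
    intro y hy
    have hcirc : ∀ θ, circleMap 0 κ θ ∈ closedBall (0 : ℂ) κ := fun θ =>
      sphere_subset_closedBall (circleMap_mem_sphere _ hκ.le _)
    simp only [circleIntegral, smul_eq_mul, ← mul_assoc]
    refine (hasFDerivAt_intervalIntegral_of_holomorphic Real.two_pi_pos.le isOpen_ball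
      ?_ ?_ hy).differentiableAt.differentiableWithinAt
    · have h0 : ∀ θ, (circleMap 0 κ θ - 0) ^ 2 ≠ 0 := fun θ => by
        rw [sub_zero]; exact pow_ne_zero _ (circleMap_ne_center hκ.ne')
      have : ContinuousOn (fun p : E × ℝ => f (p.1 + circleMap 0 κ p.2 • v))
          (ball y₀ (R / 2) ×ˢ Icc 0 (2 * Real.pi)) :=
        hf.continuousOn.comp (by fun_prop) fun p hp => hmem _ hp.1 _ (hcirc _)
      simp only [deriv_circleMap]
      refine ContinuousOn.mul (ContinuousOn.mul (by fun_prop) ?_) this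
      exact (Continuous.div (by fun_prop) (by fun_prop) fun p => h0 _).continuousOn
    · intro θ _
      refine DifferentiableOn.const_mul ?_ _
      exact hf.comp (by fun_prop) fun y hy => hmem _ hy _ (hcirc _)
  have hn := ball_mem_nhds y₀ (half_pos hR)
  refine DifferentiableAt.differentiableWithinAt ?_
  refine ((key.differentiableAt hn).const_smul (2 * Real.pi * Complex.I : ℂ)⁻¹).congr_of_eventuallyEq ?_
  filter_upwards [hn] with y hy using hformula y hy

end Holomorphic

/-! ### Taylor coefficients in a parameter, potentials of closed forms, the Riccati flow. -/

section Holomorphic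

open Metric Set MeasureTheory

/-- Each `γ`-derivative is the derivative of the previous one in the direction `(0, 1)`. At `γ = 0`
this makes the coefficients of the quantization holomorphic. -/
theorem differentiableOn_iteratedDeriv_snd {E : Type*} [NormedAddCommGroup E] [NormedSpace ℂ E]
    [ProperSpace E] {W : Set (E × ℂ)} (hW : IsOpen W) {F : E × ℂ → ℂ}
    (hF : DifferentiableOn ℂ F W) (n : ℕ) :
    DifferentiableOn ℂ (fun p : E × ℂ => iteratedDeriv n (fun γ => F (p.1, γ)) p.2) W := by
  induction n with
  | zero => simpa using hF
  | succ n ih =>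
    refine (differentiableOn_fderiv_apply hW ih (0, 1)).congr fun p hp => ?_
    have h1 := (ih.differentiableAt (hW.mem_nhds hp)).hasFDerivAt
    have h2 : HasDerivAt (fun γ : ℂ => (p.1, γ)) ((0 : E), (1 : ℂ)) p.2 :=
      (hasDerivAt_const _ _).prodMk (hasDerivAt_id _)
    rw [iteratedDeriv_succ]
    exact (HasFDerivAt.comp_hasDerivAt p.2 h1 h2).deriv

variable {ι : Type*} [Fintype ι] [DecidableEq ι]

theorem fderiv_apply_eq_sum {f : (ι → ℂ) → ℂ} (y w : ι → ℂ) :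
    fderiv ℂ f y w = ∑ a, w a * fderiv ℂ f y (Pi.single a 1) := by
  conv_lhs => rw [pi_eq_sum_univ' w]
  simp only [map_sum]
  refine Finset.sum_congr rfl fun a _ => ?_
  rw [map_smul, smul_eq_mul]

/-- The Poincaré lemma for holomorphic `2`-forms on convex open sets. -/
theorem exists_potential {Ω : Set (ι → ℂ)} (hΩ : IsOpen Ω) (hconv : Convex ℝ Ω) {y₀ : ι → ℂ}
    (hy₀ : y₀ ∈ Ω) {A : ι → ι → (ι → ℂ) → ℂ} (hA : ∀ a b, DifferentiableOn ℂ (A a b) Ω)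
    (hanti : ∀ a b, ∀ y ∈ Ω, A b a y = -A a b y)
    (hclosed : ∀ a b c, a ≠ b → b ≠ c → a ≠ c → ∀ y ∈ Ω, fderiv ℂ (A b c) y (Pi.single a 1)
      + fderiv ℂ (A c a) y (Pi.single b 1) + fderiv ℂ (A a b) y (Pi.single c 1) = 0) :
    ∃ ξ : ι → (ι → ℂ) → ℂ, (∀ b, DifferentiableOn ℂ (ξ b) Ω) ∧
      ∀ a b, ∀ y ∈ Ω, fderiv ℂ (ξ b) y (Pi.single a 1) - fderiv ℂ (ξ a) y (Pi.single b 1)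
        = A a b y := by
  have hmem : ∀ y ∈ Ω, ∀ t ∈ Icc (0 : ℝ) 1, y₀ + (t : ℂ) • (y - y₀) ∈ Ω := by
    intro y hy t ht
    have := hconv.add_smul_sub_mem hy₀ hy ht
    rwa [← Complex.coe_smul] at this
  have hanti' : ∀ a b c, ∀ y ∈ Ω, fderiv ℂ (A b a) y (Pi.single c 1)
      = -fderiv ℂ (A a b) y (Pi.single c 1) := by
    intro a b c y hy
    have : A b a =ᶠ[nhds y] fun z => -A a b z := by
      filter_upwards [hΩ.mem_nhds hy] with z hz using hanti a b z hz
    rw [this.fderiv_eq, fderiv_fun_neg]; rfl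
  -- For repeated indices closedness is a consequence of antisymmetry.
  have hclosed' : ∀ a b c, ∀ y ∈ Ω, fderiv ℂ (A b c) y (Pi.single a 1)
      + fderiv ℂ (A c a) y (Pi.single b 1) + fderiv ℂ (A a b) y (Pi.single c 1) = 0 := by
    intro a b c y hy
    by_cases hab : a = b
    · subst hab
      linear_combination hanti' a c a y hy + hanti' a a c y hy / 2
    by_cases hbc : b = c
    · subst hbc
      linear_combination hanti' a b b y hy + hanti' b b a y hy / 2
    by_cases hac : a = c
    · subst hac
      linear_combination hanti' a b a y hy + hanti' a a b y hy / 2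
    exact hclosed a b c hab hbc hac y hy
  let G : ι → (ι → ℂ) → ℝ → ℂ := fun b y t =>
    t * ∑ a, (y a - y₀ a) * A a b (y₀ + (t : ℂ) • (y - y₀))
  have hGc : ∀ b, ContinuousOn (fun p : (ι → ℂ) × ℝ => G b p.1 p.2) (Ω ×ˢ Icc 0 1) := by
    intro b
    refine ContinuousOn.mul (by fun_prop) (continuousOn_finsetSum _ fun a _ => ?_)
    refine ContinuousOn.mul (by fun_prop) ?_
    exact (hA a b).continuousOn.comp (by fun_prop) fun p hp => hmem _ hp.1 _ hp.2
  have hGd : ∀ b, ∀ t ∈ Icc (0 : ℝ) 1, ∀ y ∈ Ω, HasFDerivAt (fun y => G b y t)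
      ((t : ℂ) • ∑ a, ((y a - y₀ a) • ((t : ℂ) • fderiv ℂ (A a b) (y₀ + (t : ℂ) • (y - y₀)))
        + A a b (y₀ + (t : ℂ) • (y - y₀)) • ContinuousLinearMap.proj a)) y := by
    intro b t ht y hy
    refine HasFDerivAt.const_mul (HasFDerivAt.fun_sum fun a _ => ?_) (t : ℂ)
    refine HasFDerivAt.mul ((hasFDerivAt_apply a y).sub_const _) ?_
    have h1 := ((hA a b).differentiableAt (hΩ.mem_nhds (hmem y hy t ht))).hasFDerivAt
    have h2 : HasFDerivAt (fun y : ι → ℂ => y₀ + (t : ℂ) • (y - y₀))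
        ((t : ℂ) • ContinuousLinearMap.id ℂ (ι → ℂ)) y :=
      (((hasFDerivAt_id y).sub_const y₀).const_smul (t : ℂ)).const_add y₀
    convert! h1.comp y h2 using 1
    ext; simp
  have hGd' : ∀ b, ∀ t ∈ Icc (0 : ℝ) 1, DifferentiableOn ℂ (fun y => G b y t) Ω := fun b t ht y hy =>
    (hGd b t ht y hy).differentiableAt.differentiableWithinAt
  have hξ := fun b y (hy : y ∈ Ω) =>
    hasFDerivAt_intervalIntegral_of_holomorphic zero_le_one hΩ (hGc b) (hGd' b) hy
  refine ⟨fun b y => ∫ t in (0 : ℝ)..1, G b y t,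
    fun b y hy => (hξ b y hy).differentiableAt.differentiableWithinAt, fun c b y hy => ?_⟩
  have hint : ∀ b, IntervalIntegrable (fun t => fderiv ℂ (fun z => G b z t) y) volume 0 1 := fun b =>
    ContinuousOn.intervalIntegrable (by
      rw [uIcc_of_le zero_le_one]; exact continuousOn_fderiv_param hΩ (hGc b) (hGd' b) hy)
  have hintv : ∀ b v, IntervalIntegrable (fun t => fderiv ℂ (fun z => G b z t) y v) volume 0 1 :=
    fun b v => ContinuousOn.intervalIntegrable (by
      rw [uIcc_of_le zero_le_one]
      exact (continuousOn_fderiv_param hΩ (hGc b) (hGd' b) hy).clm_apply continuousOn_const)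
  rw [(hξ b y hy).fderiv, (hξ c y hy).fderiv,
    ContinuousLinearMap.intervalIntegral_apply (hint b),
    ContinuousLinearMap.intervalIntegral_apply (hint c),
    ← intervalIntegral.integral_sub (hintv _ _) (hintv _ _)]
  -- By closedness the curl of the integrand is the total derivative of `t² A_cb` along the segment.
  have hderiv : ∀ t ∈ uIcc (0 : ℝ) 1, HasDerivAt
      (fun t : ℝ => (t : ℂ) ^ 2 * A c b (y₀ + (t : ℂ) • (y - y₀)))
      (fderiv ℂ (fun z => G b z t) y (Pi.single c 1)
        - fderiv ℂ (fun z => G c z t) y (Pi.single b 1)) t := by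
    intro t ht
    rw [uIcc_of_le zero_le_one] at ht
    set p := y₀ + (t : ℂ) • (y - y₀) with hp
    have hpΩ : p ∈ Ω := hmem y hy t ht
    have h1 := ((hA c b).differentiableAt (hΩ.mem_nhds hpΩ)).hasFDerivAt
    have h2 : HasDerivAt (fun ζ : ℂ => y₀ + ζ • (y - y₀)) (y - y₀) (t : ℂ) := by
      simpa using ((hasDerivAt_id (t : ℂ)).smul_const (y - y₀)).const_add y₀
    have h3 := (((hasDerivAt_pow 2 (t : ℂ)).mul
      (HasFDerivAt.comp_hasDerivAt (t : ℂ) h1 h2))).comp_ofReal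
    convert! h3 using 1
    rw [(hGd b t ht y hy).fderiv, (hGd c t ht y hy).fderiv, fderiv_apply_eq_sum]
    simp only [smul_apply, sum_apply, add_apply, ContinuousLinearMap.proj_apply, smul_eq_mul,
      Finset.sum_add_distrib, Pi.single_apply, mul_ite, mul_one, mul_zero, Finset.sum_ite_eq',
      Finset.mem_univ, if_true, Function.comp, ← hp]
    have hsum : ∑ a, (y a - y₀ a) * ((t : ℂ) * fderiv ℂ (A a b) p (Pi.single c 1))
        - ∑ a, (y a - y₀ a) * ((t : ℂ) * fderiv ℂ (A a c) p (Pi.single b 1))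
        = (t : ℂ) * ∑ a, (y - y₀) a * fderiv ℂ (A c b) p (Pi.single a 1) := by
      rw [← Finset.sum_sub_distrib, Finset.mul_sum]
      refine Finset.sum_congr rfl fun a _ => ?_
      rw [Pi.sub_apply]
      linear_combination (-(y a - y₀ a) * (t : ℂ)) * hclosed' a c b p hpΩ
        + ((y a - y₀ a) * (t : ℂ)) * hanti' a b c p hpΩ
    have := hanti c b p hpΩ
    push_cast
    linear_combination (t : ℂ) * hsum - (t : ℂ) * this
  rw [intervalIntegral.integral_eq_sub_of_hasDerivAt hderiv ((hintv _ _).sub (hintv _ _))]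
  simp

/-- Grönwall's inequality with zero initial value. -/
theorem eq_zero_of_hasDerivAt_mul {g f : ℝ → ℂ} (hf : ContinuousOn f (Icc 0 1))
    (hg : ∀ t ∈ Icc (0 : ℝ) 1, HasDerivAt g (f t * g t) t) (h0 : g 0 = 0) : g 1 = 0 := by
  obtain ⟨K, hK⟩ := isCompact_Icc.exists_bound_of_continuousOn hf
  have := norm_le_gronwallBound_of_norm_deriv_right_le (f := g) (f' := fun t => f t * g t)
    (δ := 0) (K := K) (ε := 0) (a := 0) (b := 1)
    (fun t ht => (hg t ht).continuousAt.continuousWithinAt)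
    (fun t ht => (hg t (Ico_subset_Icc_self ht)).hasDerivWithinAt) (by simp [h0])
    (fun t ht => by
      rw [norm_mul, add_zero]
      exact mul_le_mul_of_nonneg_right (hK t (Ico_subset_Icc_self ht)) (norm_nonneg _)) 1
    (by simp)
  simpa [gronwallBound_ε0] using this

/-- Translates of the solutions of the Riccati equation `∂_v β = κ β²`. -/
theorem riccati_shift {E : Type*} [NormedAddCommGroup E] [NormedSpace ℂ E] {Ω : Set E}
    (hΩ : IsOpen Ω) (hconv : Convex ℝ Ω) {β : E → ℂ} (hβ : DifferentiableOn ℂ β Ω) {v : E} {κ γ : ℂ}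
    (hric : ∀ y ∈ Ω, fderiv ℂ β y v = κ * β y ^ 2) {y : E} (hy : y ∈ Ω) (hy' : y - γ • v ∈ Ω) :
    β (y - γ • v) * (1 + κ * γ * β y) = β y := by
  have hmem : ∀ t ∈ Icc (0 : ℝ) 1, y - ((t : ℂ) * γ) • v ∈ Ω := by
    intro t ht
    have := hconv.add_smul_sub_mem hy hy' ht
    rw [← Complex.coe_smul, sub_sub_cancel_left, smul_neg, smul_smul] at this
    rwa [sub_eq_add_neg]
  have hd : ∀ t ∈ Icc (0 : ℝ) 1, HasDerivAt (fun t : ℝ => β (y - ((t : ℂ) * γ) • v))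
      (-(κ * γ) * β (y - ((t : ℂ) * γ) • v) ^ 2) t := by
    intro t ht
    have h1 := (hβ.differentiableAt (hΩ.mem_nhds (hmem t ht))).hasFDerivAt
    have h2 : HasDerivAt (fun ζ : ℂ => y - (ζ * γ) • v) (-(γ • v)) (t : ℂ) := by
      simpa using (((hasDerivAt_id (t : ℂ)).mul_const γ).smul_const v).const_sub y
    convert! (HasFDerivAt.comp_hasDerivAt (t : ℂ) h1 h2).comp_ofReal using 1
    rw [map_neg, map_smul, hric _ (hmem t ht), smul_eq_mul]; ring
  -- The defect of the claimed identity solves a homogeneous linear equation along the segment;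
  -- neither `β` nor `1 + κγβ` has to be inverted.
  have := eq_zero_of_hasDerivAt_mul
    (g := fun t : ℝ => β (y - ((t : ℂ) * γ) • v) * (1 + (t : ℂ) * (κ * γ * β y)) - β y)
    (f := fun t => -(κ * γ) * β (y - ((t : ℂ) * γ) • v))
    (fun t ht => (((hd t ht).continuousAt.continuousWithinAt).const_mul _)) (fun t ht => by
      have h3 : HasDerivAt (fun t : ℝ => (1 + (t : ℂ) * (κ * γ * β y))) (κ * γ * β y) t := by
        simpa using ((Complex.ofRealCLM.hasDerivAt (x := t)).mul_const (κ * γ * β y)).const_add 1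
      convert! ((hd t ht).mul h3).sub_const (β y) using 1
      ring) (by simp)
  simpa [sub_eq_zero] using this

end Holomorphic

/-! ### Homogeneous weight bases. -/

section WeightBasis

variable {𝔥 V : Type*} [AddCommGroup 𝔥] [Module ℂ 𝔥] [AddCommGroup V] [Module ℂ V]

theorem mem_weightSpace {ρ : 𝔥 →ₗ[ℂ] Module.End ℂ V} {ω : Module.Dual ℂ 𝔥} {u : V} :
    u ∈ weightSpace ρ ω ↔ ∀ h, ρ h u = ω h • u := by
  simp [weightSpace, Submodule.mem_iInf]

theorem exists_ne_zero_of_mem_weights {ρ : 𝔥 →ₗ[ℂ] Module.End ℂ V} {ω : Module.Dual ℂ 𝔥}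
    (hω : ω ∈ weights ρ) : ∃ u ≠ 0, ∀ h, ρ h u = ω h • u := by
  obtain ⟨u, hu, h0⟩ := (Submodule.ne_bot_iff _).1 hω
  exact ⟨u, h0, mem_weightSpace.1 hu⟩

variable [FiniteDimensional ℂ 𝔥]

theorem eq_zero_of_weights_apply_eq_zero {ρ : 𝔥 →ₗ[ℂ] Module.End ℂ V} (hwt : WeightsFormBasis ρ)
    {x : 𝔥} (hx : ∀ ω ∈ weights ρ, ω x = 0) : x = 0 := by
  rw [← Module.forall_dual_apply_eq_zero_iff ℂ]
  intro f
  have hf : f ∈ Submodule.span ℂ (weights ρ) := by rw [hwt.span_eq_top]; trivial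
  induction hf using Submodule.span_induction with
  | mem ω h => exact hx ω h
  | zero => simp
  | add f g _ _ hf hg => simp [hf, hg]
  | smul c f _ hf => simp [hf]

variable {𝒽 : ZMod 2 → Submodule ℂ 𝔥} [DirectSum.Decomposition 𝒽]
  {𝒱 : ZMod 2 → Submodule ℂ V} [DirectSum.Decomposition 𝒱] {ρ : 𝔥 →ₗ[ℂ] Module.End ℂ V}

-- The supercommutator of an odd `x` with itself is `2 ρ(x)²`, so every weight vanishes on `x`, and
-- the weights span the dual.
omit [DirectSum.Decomposition 𝒽] [DirectSum.Decomposition 𝒱] in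
theorem eq_zero_of_odd (hρ : IsModule 𝒽 𝒱 ρ) (hwt : WeightsFormBasis ρ) {x : 𝔥} (hx : x ∈ 𝒽 1) :
    x = 0 := by
  refine eq_zero_of_weights_apply_eq_zero hwt fun ω hω => ?_
  obtain ⟨u, hu0, hu⟩ := exists_ne_zero_of_mem_weights hω
  have h := LinearMap.congr_fun (hρ.supercomm 1 1 x hx x hx) u
  have hone : (-1 : ℤˣ) ^ ((1 : ZMod 2) * 1) = -1 := by decide
  rw [hone] at h
  simp only [Units.neg_smul, one_smul, LinearMap.add_apply,
    Module.End.mul_apply, hu, map_smul, LinearMap.zero_apply, smul_smul, sub_neg_eq_add,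
    ← add_smul] at h
  have := (smul_eq_zero.1 h).resolve_right hu0
  have h2 : ω x * ω x = 0 := by linear_combination this / 2
  simpa using h2

omit [DirectSum.Decomposition 𝒱] in
theorem map_mem_of_mem (hρ : IsModule 𝒽 𝒱 ρ) (hwt : WeightsFormBasis ρ) (x : 𝔥) {j : ZMod 2}
    {u : V} (hu : u ∈ 𝒱 j) : ρ x u ∈ 𝒱 j := by
  have hx : x ∈ 𝒽 0 := by
    classical
    have := DirectSum.sum_support_decompose 𝒽 x
    rw [← this]
    refine Submodule.sum_mem _ fun i _ => ?_
    have hi : ∀ i : ZMod 2, i = 0 ∨ i = 1 := by decide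
    obtain rfl | rfl := hi i
    · exact SetLike.coe_mem _
    · rw [eq_zero_of_odd hρ hwt (SetLike.coe_mem _)]; exact Submodule.zero_mem _
  simpa using hρ.parity 0 j x hx u hu

/-- As all of `𝔥` is even, the action commutes with the parity projections, so any nonzero
homogeneous component of a weight vector serves. -/
theorem exists_homogeneous_weight_vector (hρ : IsModule 𝒽 𝒱 ρ) (hwt : WeightsFormBasis ρ)
    {ω : Module.Dual ℂ 𝔥} (hω : ω ∈ weights ρ) :
    ∃ (u : V) (j : ZMod 2), u ≠ 0 ∧ u ∈ 𝒱 j ∧ ∀ h, ρ h u = ω h • u := by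
  obtain ⟨u, hu0, hu⟩ := exists_ne_zero_of_mem_weights hω
  obtain ⟨j, hj⟩ : ∃ j, (DirectSum.decompose 𝒱 u j : V) ≠ 0 := by
    by_contra! hall
    apply hu0
    classical
    rw [← DirectSum.sum_support_decompose 𝒱 u]
    exact Finset.sum_eq_zero fun i _ => hall i
  refine ⟨DirectSum.decompose 𝒱 u j, j, hj, SetLike.coe_mem _, fun h => ?_⟩
  have hcomm : (DirectSum.decompose 𝒱 (ρ h u) j : V) = ρ h (DirectSum.decompose 𝒱 u j) := by
    classical
    conv_lhs => rw [← DirectSum.sum_support_decompose 𝒱 u, map_sum]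
    rw [DirectSum.decompose_sum, DFinsupp.finsetSum_apply, AddSubmonoidClass.coe_finsetSum]
    rw [Finset.sum_eq_single j]
    · exact DirectSum.decompose_of_mem_same 𝒱 (map_mem_of_mem hρ hwt h (SetLike.coe_mem _))
    · intro i _ hij
      exact DirectSum.decompose_of_mem_ne 𝒱 (map_mem_of_mem hρ hwt h (SetLike.coe_mem _)) hij
    · intro hj'
      rw [DFinsupp.notMem_support_iff.1 hj']; simp
  rw [← hcomm, hu, DirectSum.decompose_smul]
  rfl

variable [FiniteDimensional ℂ V]

theorem exists_homogeneous_weight_basis (hρ : IsModule 𝒽 𝒱 ρ) (hwt : WeightsFormBasis ρ) :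
    ∃ (n : ℕ) (v : Module.Basis (Fin n) ℂ V) (ω : Module.Basis (Fin n) ℂ (Module.Dual ℂ 𝔥))
      (p : Fin n → ZMod 2), (∀ a, v a ∈ 𝒱 (p a)) ∧ ∀ h a, ρ h (v a) = ω a h • v a := by
  let ω₀ : Module.Basis (weights ρ) ℂ (Module.Dual ℂ 𝔥) :=
    Module.Basis.mk hwt.linearIndependent (by simp [hwt.span_eq_top])
  have : Finite (weights ρ) := Module.Finite.finite_basis ω₀
  have : Fintype (weights ρ) := Fintype.ofFinite _
  let ω := ω₀.reindex (Fintype.equivFin _)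
  have hω : ∀ a, ω a ∈ weights ρ := fun a => by simp [ω, ω₀]
  choose u p hu0 hup hu using fun a => exists_homogeneous_weight_vector hρ hwt (hω a)
  have hli : LinearIndependent ℂ u := by
    rw [Fintype.linearIndependent_iff]
    intro g hg a
    -- The element dual to `ω a` acts on a linear relation by isolating its `a`-th term.
    obtain ⟨x, hx⟩ : ∃ x : 𝔥, ∀ b, ω b x = if a = b then 1 else 0 := by
      obtain ⟨x, hx⟩ := (Module.evalEquiv ℂ 𝔥).surjective (ω.coord a)
      refine ⟨x, fun b => ?_⟩
      have := LinearMap.congr_fun hx (ω b)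
      simpa [Finsupp.single_apply, eq_comm] using this
    have := congrArg (ρ x) hg
    simp only [map_sum, map_smul, hu, hx, ite_smul, one_smul, zero_smul, smul_ite, smul_zero,
      Finset.sum_ite_eq, Finset.mem_univ, if_true, map_zero] at this
    exact (smul_eq_zero.1 this).resolve_right (hu0 a)
  have hcard : Fintype.card (Fin (Fintype.card (weights ρ))) = Module.finrank ℂ V := by
    rw [hwt.finrank_eq, ← Subspace.dual_finrank_eq, Module.finrank_eq_card_basis ω]
  refine ⟨_, basisOfLinearIndependentOfCardEqFinrank' u hli hcard, ω, p, ?_, ?_⟩ <;> simp_all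

end WeightBasis

/-! ### Operators with a diagonal and a flip coefficient. -/

section WeightOperators

variable {V : Type*} [AddCommGroup V] [Module ℂ V] {ι : Type*} (v : Module.Basis ι ℂ V)

/-- The operator `v_a ⊗ v_b ↦ α_ab v_a ⊗ v_b + β_ab v_b ⊗ v_a`. -/
noncomputable def weightOp (α β : ι → ι → ℂ) : Module.End ℂ (V ⊗[ℂ] V) :=
  (v.tensorProduct v).constr ℂ fun x =>
    α x.1 x.2 • v x.1 ⊗ₜ[ℂ] v x.2 + β x.1 x.2 • v x.2 ⊗ₜ[ℂ] v x.1

theorem weightOp_tmul (α β : ι → ι → ℂ) (a b : ι) : weightOp v α β (v a ⊗ₜ v b) =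
    α a b • v a ⊗ₜ[ℂ] v b + β a b • v b ⊗ₜ[ℂ] v a := by
  have := (v.tensorProduct v).constr_basis ℂ (fun x : ι × ι =>
    α x.1 x.2 • v x.1 ⊗ₜ[ℂ] v x.2 + β x.1 x.2 • v x.2 ⊗ₜ[ℂ] v x.1) (a, b)
  rwa [Module.Basis.tensorProduct_apply] at this

variable {v} in
theorem ext_basis_two {W : Type*} [AddCommGroup W] [Module ℂ W] {S T : V ⊗[ℂ] V →ₗ[ℂ] W}
    (h : ∀ a b, S (v a ⊗ₜ v b) = T (v a ⊗ₜ v b)) : S = T :=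
  (v.tensorProduct v).ext fun x => by rw [Module.Basis.tensorProduct_apply]; exact h _ _

variable {v} in
theorem ext_basis_three {W : Type*} [AddCommGroup W] [Module ℂ W]
    {S T : V ⊗[ℂ] (V ⊗[ℂ] V) →ₗ[ℂ] W}
    (h : ∀ a b c, S (v a ⊗ₜ (v b ⊗ₜ v c)) = T (v a ⊗ₜ (v b ⊗ₜ v c))) : S = T :=
  (v.tensorProduct (v.tensorProduct v)).ext fun x => by
    rw [Module.Basis.tensorProduct_apply, Module.Basis.tensorProduct_apply]; exact h _ _ _

/-- The sign `(-1)^(|a||b|)` of two basis vectors with parities `p`. -/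
def basisSign (p : ι → ZMod 2) (a b : ι) : ℂ := (((-1 : ℤˣ) ^ (p a * p b) : ℤˣ) : ℤ)

theorem basisSign_comm (p : ι → ZMod 2) (a b : ι) : basisSign p a b = basisSign p b a := by
  rw [basisSign, mul_comm]; rfl

theorem basisSign_mul_self (p : ι → ZMod 2) (a b : ι) : basisSign p a b * basisSign p a b = 1 := by
  rw [basisSign, ← Int.cast_mul, ← Units.val_mul, Int.units_mul_self]; simp

variable {v} {𝒱 : ZMod 2 → Submodule ℂ V} [DirectSum.Decomposition 𝒱] {p : ι → ZMod 2}
  (hp : ∀ a, v a ∈ 𝒱 (p a))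
include hp

theorem superTwist_basis (a b : ι) :
    superTwist 𝒱 (v a ⊗ₜ v b) = basisSign p a b • v b ⊗ₜ[ℂ] v a := by
  rw [superTwist_tmul 𝒱 (hp a) (hp b), basisSign, Units.smul_def, Int.cast_smul_eq_zsmul]

omit hp [DirectSum.Decomposition 𝒱] in
theorem op12_tmul (T : Module.End ℂ (V ⊗[ℂ] V)) (x y z : V) :
    op12 T (x ⊗ₜ (y ⊗ₜ z)) = TensorProduct.assoc ℂ V V V (T (x ⊗ₜ y) ⊗ₜ z) := by
  simp [op12]

omit hp in
theorem op12_weightOp (α β : ι → ι → ℂ) (a b c : ι) :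
    op12 (weightOp v α β) (v a ⊗ₜ (v b ⊗ₜ v c)) =
      α a b • v a ⊗ₜ (v b ⊗ₜ v c) + β a b • v b ⊗ₜ[ℂ] (v a ⊗ₜ[ℂ] v c) := by
  simp [op12_tmul, weightOp_tmul, TensorProduct.add_tmul, ← TensorProduct.smul_tmul']

omit hp in
theorem op23_weightOp (α β : ι → ι → ℂ) (a b c : ι) :
    op23 (weightOp v α β) (v a ⊗ₜ (v b ⊗ₜ v c)) =
      α b c • v a ⊗ₜ (v b ⊗ₜ v c) + β b c • v a ⊗ₜ[ℂ] (v c ⊗ₜ[ℂ] v b) := by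
  simp [op23, weightOp_tmul, TensorProduct.tmul_add]

theorem op12_superTwist (a b c : ι) : op12 (superTwist 𝒱) (v a ⊗ₜ (v b ⊗ₜ v c)) =
    basisSign p a b • v b ⊗ₜ[ℂ] (v a ⊗ₜ[ℂ] v c) := by
  rw [op12_tmul, superTwist_basis hp, ← TensorProduct.smul_tmul', map_smul]; simp

theorem op23_superTwist (a b c : ι) : op23 (superTwist 𝒱) (v a ⊗ₜ (v b ⊗ₜ v c)) =
    basisSign p b c • v a ⊗ₜ[ℂ] (v c ⊗ₜ[ℂ] v b) := by
  simp [op23, superTwist_basis hp]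

theorem op13_weightOp (α β : ι → ι → ℂ) (a b c : ι) :
    op13 𝒱 (weightOp v α β) (v a ⊗ₜ (v b ⊗ₜ v c)) = α a c • v a ⊗ₜ (v b ⊗ₜ v c)
      + (basisSign p a b * basisSign p b c * β a c) • v c ⊗ₜ[ℂ] (v b ⊗ₜ[ℂ] v a) := by
  simp only [op13, Module.End.mul_apply, op23_superTwist hp, map_smul, op12_weightOp, map_add,
    smul_add, smul_smul]
  congr 2
  · rw [basisSign_comm p c b]; linear_combination α a c * basisSign_mul_self p b c
  · ring

theorem twistOp_weightOp (α β : ι → ι → ℂ) :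
    twistOp 𝒱 (weightOp v α β) = weightOp v (fun a b => α b a) (fun a b => β b a) := by
  refine ext_basis_two (v := v) fun a b => ?_
  simp only [twistOp, Module.End.mul_apply, superTwist_basis hp, map_smul, weightOp_tmul, map_add,
    smul_add, smul_smul]
  congr 2
  · rw [basisSign_comm p b a]; linear_combination α b a * basisSign_mul_self p a b
  · linear_combination β b a * basisSign_mul_self p a b

end WeightOperators

/-! ### The matrix form of zero weight operators. -/

section ZeroWeight

variable {𝔥 V : Type*} [AddCommGroup 𝔥] [Module ℂ 𝔥] [AddCommGroup V] [Module ℂ V]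
  {ρ : 𝔥 →ₗ[ℂ] Module.End ℂ V} {ι : Type*} {v : Module.Basis ι ℂ V}
  {ω : Module.Basis ι ℂ (Module.Dual ℂ 𝔥)} (hv : ∀ h a, ρ h (v a) = ω a h • v a)
include hv

theorem weight_action_tmul (h : 𝔥) (a b : ι) :
    ((ρ h).rTensor V + (ρ h).lTensor V) (v a ⊗ₜ v b) = (ω a h + ω b h) • v a ⊗ₜ[ℂ] v b := by
  simp [hv, add_smul, ← TensorProduct.smul_tmul']

theorem hasZeroWeight_weightOp (α β : ι → ι → ℂ) : HasZeroWeight ρ (weightOp v α β) := by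
  intro h
  refine ext_basis_two (v := v) fun a b => ?_
  rw [Ring.lie_def, LinearMap.sub_apply, Module.End.mul_apply, Module.End.mul_apply,
    weight_action_tmul hv, weightOp_tmul, map_add, map_smul, map_smul, map_smul,
    weight_action_tmul hv, weight_action_tmul hv, weightOp_tmul, LinearMap.zero_apply]
  module

/-- A nonzero entry from `(a, b)` to `(c, d)` requires `ω c + ω d = ω a + ω b`, and independence
then makes the index pairs equal up to order. For `a = b` the two target vectors coincide, so the
flip coefficient is set to zero. -/
theorem eq_weightOp_of_hasZeroWeight [DecidableEq ι] {T : Module.End ℂ (V ⊗[ℂ] V)}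
    (hT : HasZeroWeight ρ T) :
    T = weightOp v (fun a b => (v.tensorProduct v).repr (T (v a ⊗ₜ v b)) (a, b))
      (fun a b => if a = b then 0 else (v.tensorProduct v).repr (T (v a ⊗ₜ v b)) (b, a)) := by
  refine ext_basis_two (v := v) fun a b => ?_
  have hact : ∀ (h : 𝔥) (x : V ⊗[ℂ] V) (c d : ι), (v.tensorProduct v).repr
      (((ρ h).rTensor V + (ρ h).lTensor V) x) (c, d)
        = (ω c h + ω d h) * (v.tensorProduct v).repr x (c, d) := by
    intro h x c d
    have : (v.tensorProduct v).coord (c, d) ∘ₗ ((ρ h).rTensor V + (ρ h).lTensor V)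
        = (ω c h + ω d h) • (v.tensorProduct v).coord (c, d) := by
      refine ext_basis_two (v := v) fun a b => ?_
      rw [LinearMap.comp_apply, weight_action_tmul hv]
      simp only [map_smul, LinearMap.smul_apply, Module.Basis.coord_apply,
        Module.Basis.tensorProduct_repr_tmul_apply, Module.Basis.repr_self, smul_eq_mul,
        Finsupp.single_apply]
      split_ifs <;> simp_all
    exact LinearMap.congr_fun this x
  have hker : ∀ c d, (v.tensorProduct v).repr (T (v a ⊗ₜ v b)) (c, d) ≠ 0 →
      (c = a ∧ d = b) ∨ (c = b ∧ d = a) := by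
    intro c d hcd
    have hω : ω c + ω d = ω a + ω b := by
      ext h
      have h1 := LinearMap.congr_fun (hT h) (v a ⊗ₜ v b)
      rw [Ring.lie_def, LinearMap.sub_apply, Module.End.mul_apply, Module.End.mul_apply,
        weight_action_tmul hv, map_smul, LinearMap.zero_apply] at h1
      have h2 := congrArg (fun x => (v.tensorProduct v).repr x (c, d)) h1
      simp only [map_sub, Finsupp.sub_apply, hact, map_smul, Finsupp.smul_apply, smul_eq_mul,
        map_zero, Finsupp.zero_apply] at h2
      rw [← sub_mul] at h2
      exact sub_eq_zero.1 ((mul_eq_zero.1 h2).resolve_right hcd)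
    have := congrArg ω.repr hω
    simp only [map_add, Module.Basis.repr_self] at this
    rw [Finsupp.single_add_single_eq_single_add_single (one_ne_zero (α := ℂ))
      (one_ne_zero (α := ℂ))] at this
    -- This excludes the third alternative of the criterion, in which the two coefficients cancel.
    have htwo : (0 : ℂ) ≠ 1 + 1 := by norm_num
    simpa [eq_comm, htwo] using this
  rw [weightOp_tmul]
  refine (v.tensorProduct v).ext_elem fun x => ?_
  obtain ⟨c, d⟩ := x
  simp only [map_add, map_smul, Finsupp.add_apply, Finsupp.smul_apply, smul_eq_mul,
    Module.Basis.tensorProduct_repr_tmul_apply, Module.Basis.repr_self, Finsupp.single_apply]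
  generalize (v.tensorProduct v).repr (T (v a ⊗ₜ v b)) = t at hker ⊢
  clear hact hT hv
  have hcd := hker c d
  by_cases h : t (c, d) = 0 <;> grind

end ZeroWeight

/-! ### The quantum dynamical Yang–Baxter equation in a weight basis. -/

section Quantum

variable {V : Type*} [AddCommGroup V] [Module ℂ V] {ι : Type*} [Fintype ι] [DecidableEq ι]
  (v : Module.Basis ι ℂ V)

/-- The projection of `V` to the line spanned by `v c`. -/
noncomputable def lineProj (c : ι) : Module.End ℂ V := (v.coord c).smulRight (v c)

omit [Fintype ι] in
theorem lineProj_basis (c d : ι) : lineProj v c (v d) = if c = d then v d else 0 := by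
  by_cases h : c = d
  · simp [lineProj, h]
  · simp [lineProj, h]

/-- `∑ c, R c * P c`, where `P c` is the projection of the first factor to the line of `v c`. -/
noncomputable def shiftFst (R : ι → Module.End ℂ (V ⊗[ℂ] (V ⊗[ℂ] V))) :
    Module.End ℂ (V ⊗[ℂ] (V ⊗[ℂ] V)) := ∑ c, R c * (lineProj v c).rTensor (V ⊗[ℂ] V)

/-- `∑ c, R c * P c`, where `P c` is the projection of the second factor to the line of `v c`. -/
noncomputable def shiftSnd (R : ι → Module.End ℂ (V ⊗[ℂ] (V ⊗[ℂ] V))) :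
    Module.End ℂ (V ⊗[ℂ] (V ⊗[ℂ] V)) := ∑ c, R c * ((lineProj v c).rTensor V).lTensor V

/-- `∑ c, R c * P c`, where `P c` is the projection of the third factor to the line of `v c`. -/
noncomputable def shiftTrd (R : ι → Module.End ℂ (V ⊗[ℂ] (V ⊗[ℂ] V))) :
    Module.End ℂ (V ⊗[ℂ] (V ⊗[ℂ] V)) := ∑ c, R c * ((lineProj v c).lTensor V).lTensor V

variable {v}

theorem shiftFst_tmul (R : ι → Module.End ℂ (V ⊗[ℂ] (V ⊗[ℂ] V))) (a : ι) (y z : V) :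
    shiftFst v R (v a ⊗ₜ (y ⊗ₜ z)) = R a (v a ⊗ₜ (y ⊗ₜ z)) := by
  rw [shiftFst, LinearMap.sum_apply, Finset.sum_eq_single a] <;>
    simp +contextual [lineProj_basis]

theorem shiftSnd_tmul (R : ι → Module.End ℂ (V ⊗[ℂ] (V ⊗[ℂ] V))) (x : V) (b : ι) (z : V) :
    shiftSnd v R (x ⊗ₜ (v b ⊗ₜ z)) = R b (x ⊗ₜ (v b ⊗ₜ z)) := by
  rw [shiftSnd, LinearMap.sum_apply, Finset.sum_eq_single b] <;>
    simp +contextual [lineProj_basis]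

theorem shiftTrd_tmul (R : ι → Module.End ℂ (V ⊗[ℂ] (V ⊗[ℂ] V))) (x y : V) (c : ι) :
    shiftTrd v R (x ⊗ₜ (y ⊗ₜ v c)) = R c (x ⊗ₜ (y ⊗ₜ v c)) := by
  rw [shiftTrd, LinearMap.sum_apply, Finset.sum_eq_single c] <;>
    simp +contextual [lineProj_basis]

-- A nonzero `a`-th coordinate of a vector of weight `χ` forces `χ = ω a`. This reduces the
-- conditions on shifted operators to basis vectors.
omit [Fintype ι] in
theorem exists_eq_weight {𝔥 : Type*} [AddCommGroup 𝔥] [Module ℂ 𝔥] {ρ : 𝔥 →ₗ[ℂ] Module.End ℂ V}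
    {ω : Module.Basis ι ℂ (Module.Dual ℂ 𝔥)} (hv : ∀ h a, ρ h (v a) = ω a h • v a)
    {χ : Module.Dual ℂ 𝔥} (hχ : χ ∈ weights ρ) :
    ∃ a, χ = ω a ∧ ∀ u ∈ weightSpace ρ χ, ∃ k : ℂ, u = k • v a := by
  have hact : ∀ h u a, v.repr (ρ h u) a = ω a h * v.repr u a := by
    intro h u a
    have : v.coord a ∘ₗ ρ h = ω a h • v.coord a := by
      refine v.ext fun b => ?_
      by_cases hab : b = a <;> simp [hv, hab]
    exact LinearMap.congr_fun this u
  have hco : ∀ u ∈ weightSpace ρ χ, ∀ a, v.repr u a ≠ 0 → χ = ω a := by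
    intro u hu a ha
    ext h
    have h1 := hact h u a
    rw [mem_weightSpace.1 hu, map_smul, Finsupp.smul_apply, smul_eq_mul] at h1
    exact mul_right_cancel₀ ha h1
  obtain ⟨u, hu, hu0⟩ := (Submodule.ne_bot_iff _).1 hχ
  obtain ⟨a, ha⟩ : ∃ a, v.repr u a ≠ 0 := by
    by_contra! hall
    exact hu0 (v.ext_elem fun a => by simp [hall a])
  refine ⟨a, hco u hu a ha, fun w hw => ⟨v.repr w a, v.ext_elem fun b => ?_⟩⟩
  by_cases hb : v.repr w b = 0
  · by_cases hab : a = b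
    · simp [hab]
    · simp [hb, hab]
  · have := ω.injective ((hco u hu a ha).symm.trans (hco w hw b hb))
    simp [this]

/-- The relations that make `v_a ⊗ v_b ↦ α_ab v_a ⊗ v_b - γ s_ab β_ab v_b ⊗ v_a` satisfy the quantum
dynamical Yang-Baxter equation. Here `α' c` and `β' c` are the shifts of `α` and `β` by the weight
of `v c`. -/
structure QuantumRelations (s : ι → ι → ℂ) (γ : ℂ) (α β : ι → ι → ℂ) (α' β' : ι → ι → ι → ℂ) :
    Prop where
  comm : ∀ a b, s a b = s b a
  sq : ∀ a b, s a b * s a b = 1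
  anti : ∀ a b, β b a = -β a b
  anti' : ∀ c a b, β' c b a = -β' c a b
  diag : ∀ a, α a a = 1
  diag' : ∀ c a, α' c a a = 1
  det : ∀ a b, α a b * α b a = 1 - γ ^ 2 * β a b ^ 2
  det' : ∀ c a b, α' c a b * α' c b a = 1 - γ ^ 2 * β' c a b ^ 2
  shift : ∀ a b c, c ≠ a → c ≠ b → β' c a b = β a b
  riccati : ∀ a b, a ≠ b → β' a a b * (1 + s a a * γ * β a b) = β a b
  triangle : ∀ a b c, a ≠ b → b ≠ c → a ≠ c → β a b * β b c = β a c * (β a b + β b c)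
  closed : ∀ a b c, a ≠ b → b ≠ c → a ≠ c →
    α' a b c * α a c * α' c a b = α a b * α' b a c * α b c

variable {s : ι → ι → ℂ} {γ : ℂ} {α β : ι → ι → ℂ} {α' β' : ι → ι → ι → ℂ}

-- Both sides are expanded on `e a b c` and compared coefficientwise, according to which indices
-- coincide. With exactly two equal indices the shifts of `β` enter through `riccati`; with three
-- distinct ones `β` is unshifted.
omit [Fintype ι] in
theorem QuantumRelations.yangBaxter (H : QuantumRelations s γ α β α' β') {W : Type*}
    [AddCommGroup W] [Module ℂ W] (e : ι → ι → ι → W) {A B C R₁₂ R₁₃ R₂₃ : W →ₗ[ℂ] W}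
    (hA : ∀ a b c, A (e a b c) = α' c a b • e a b c + (-(γ * s a b * β' c a b)) • e b a c)
    (hB : ∀ a b c, B (e a b c) = α' a b c • e a b c + (-(γ * s b c * β' a b c)) • e a c b)
    (hC : ∀ a b c, C (e a b c) = α' b a c • e a b c
      + (s a b * s b c * (-(γ * s a c * β' b a c))) • e c b a)
    (h12 : ∀ a b c, R₁₂ (e a b c) = α a b • e a b c + (-(γ * s a b * β a b)) • e b a c)
    (h23 : ∀ a b c, R₂₃ (e a b c) = α b c • e a b c + (-(γ * s b c * β b c)) • e a c b)
    (h13 : ∀ a b c, R₁₃ (e a b c) = α a c • e a b c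
      + (s a b * s b c * (-(γ * s a c * β a c))) • e c b a) (a b c : ι) :
    A (R₁₃ (B (e a b c))) = R₂₃ (C (R₁₂ (e a b c))) := by
  simp only [hA, hB, hC, h12, h13, h23, map_add, map_smul, smul_add, smul_smul]
  have h0 : ∀ a, β a a = 0 := fun a => by
    have := H.anti a a; linear_combination this / 2
  have h0' : ∀ c a, β' c a a = 0 := fun c a => by
    have := H.anti' c a a; linear_combination this / 2
  by_cases hab : a = b
  · subst hab
    by_cases hac : a = c
    · subst hac
      simp only [h0, h0', H.diag, H.diag']
    · have hr := H.riccati a c hac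
      have hd := H.det' a a c
      have hs := H.sq a c
      have hs' := H.sq a a
      simp only [h0, h0', H.diag, H.diag', H.anti' a a c, H.comm c a]
      linear_combination (norm := module)
        (-γ * s a c * α' a a c * hr - γ ^ 2 * s a c * s a a * β a c * β' a a c * α' a a c * hs) •
          e a c a
        + (-γ * s a a * s a c ^ 2 * β a c * hd + s a c ^ 2 * (γ * s a a + γ ^ 2 * β' a a c) * hr
          - s a c ^ 2 * γ ^ 2 * β a c * β' a a c * hs') • e c a a
  · by_cases hbc : b = c
    · subst hbc
      have hr := H.riccati b a (Ne.symm hab)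
      have hd := H.det a b
      have hs := H.sq a b
      have hs' := H.sq b b
      simp only [h0, h0', H.diag, H.diag', H.anti' b a b, H.anti a b, H.comm b a] at hr ⊢
      linear_combination (norm := module)
        (γ * s a b * α a b * hr + γ ^ 2 * s a b * α a b * s b b * β a b * β' b a b * hs) • e b a b
        + (γ * s a b ^ 2 * s b b * β' b a b * hd
          - s a b ^ 2 * (γ * s b b + γ ^ 2 * β a b) * hr
          + s a b ^ 2 * γ ^ 2 * β a b * β' b a b * hs') • e b b a
    · by_cases hac : a = c
      -- On `e a b a` the two determinant relations differ by the squares of `β` and its shift,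
      -- which the Riccati relation compensates.
      · subst hac
        have hr := H.riccati a b hab
        have hd := H.det a b
        have hd' := H.det' a a b
        have hs := H.sq a b
        simp only [h0, h0', H.diag, H.diag', H.anti' a a b, H.anti a b, H.comm b a]
        linear_combination (norm := module)
          (hd' - hd - γ ^ 2 * (β a b + β' a a b) * hr
            - s a a * γ ^ 3 * β a b * β' a a b * (β a b + β' a a b) * (s a b ^ 2 + 1) * hs) • e a b a
          + (-γ * s a b * α' a b a * hr
            - γ ^ 2 * s a b * s a a * β a b * β' a a b * α' a b a * hs) • e b a a
          + (γ * s a b * α a b * hr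
            + γ ^ 2 * s a b * s a a * β a b * β' a a b * α a b * hs) • e a a b
      -- Here the coefficient of `e a b c` is the cocycle condition, and those of the cyclic
      -- permutations and the reversal follow from the triangle relation, the last also from the
      -- determinants; the others agree identically.
      · have hab' := H.sq a b
        have hbc' := H.sq b c
        have ht := H.triangle a b c hab hbc hac
        have hd := H.det a b
        have hd' := H.det' a b c
        have hcl := H.closed a b c hab hbc hac
        rw [H.shift b c a hab hac] at hd'
        simp only [H.shift b c a hab hac, H.shift c b a hac hab, H.shift a c b (Ne.symm hab) hbc,
          H.shift a b c (Ne.symm hac) (Ne.symm hbc), H.anti b c, H.anti a b,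
          H.comm b a, H.comm c b]
        linear_combination (norm := module)
          hcl • e a b c
          + (-γ * s a b * s b c * s a c * β a c * (hd' - hd)
            + γ ^ 3 * s a b * s b c * s a c * (β a b - β b c) * ht
            - γ ^ 3 * s a b * s b c * s a c * β b c ^ 2 * β a b * hbc'
            + γ ^ 3 * s a b * s b c * s a c * β a b ^ 2 * β b c * hab') • e c b a
          + (α' a b c * γ ^ 2 * s a b * s a c * ht
            + α' a b c * γ ^ 2 * s a b * s a c * (β a b * β b c - β a c * β b c) * hbc') • e b c a
          + (-α a b * γ ^ 2 * s b c * s a c * ht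
            + α a b * γ ^ 2 * s b c * s a c * (β a c * β a b - β a b * β b c) * hab') • e c a b

variable {𝔥 : Type*} [AddCommGroup 𝔥] [Module ℂ 𝔥]
  {ρ : 𝔥 →ₗ[ℂ] Module.End ℂ V} {ω : Module.Basis ι ℂ (Module.Dual ℂ 𝔥)}
  {𝒱 : ZMod 2 → Submodule ℂ V} [DirectSum.Decomposition 𝒱] {p : ι → ZMod 2}

theorem qdybe_weightOp (hv : ∀ h a, ρ h (v a) = ω a h • v a) (hp : ∀ a, v a ∈ 𝒱 (p a))
    (H : QuantumRelations (basisSign p) γ α β α' β')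
    {R : Module.Dual ℂ 𝔥 → Module.End ℂ (V ⊗[ℂ] V)} {z : Module.Dual ℂ 𝔥}
    (hR : R z = weightOp v α fun a b => -(γ * basisSign p a b * β a b))
    (hR' : ∀ c, R (z - γ • ω c) =
      weightOp v (α' c) fun a b => -(γ * basisSign p a b * β' c a b)) :
    QDYBE 𝒱 ρ γ R z := by
  refine ⟨shiftTrd v fun c => op12 (R (z - γ • ω c)), shiftFst v fun c => op23 (R (z - γ • ω c)),
    shiftSnd v fun c => op13 𝒱 (R (z - γ • ω c)), ?_, ?_, ?_, ?_⟩
  · intro χ hχ x y w hw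
    obtain ⟨c, rfl, h⟩ := exists_eq_weight hv hχ
    obtain ⟨k, rfl⟩ := h w hw
    simp only [TensorProduct.tmul_smul, map_smul, shiftTrd_tmul]
  · intro χ hχ x hx y w
    obtain ⟨c, rfl, h⟩ := exists_eq_weight hv hχ
    obtain ⟨k, rfl⟩ := h x hx
    simp only [← TensorProduct.smul_tmul', map_smul, shiftFst_tmul]
  · intro χ hχ x y hy w
    obtain ⟨c, rfl, h⟩ := exists_eq_weight hv hχ
    obtain ⟨k, rfl⟩ := h y hy
    simp only [← TensorProduct.smul_tmul', TensorProduct.tmul_smul, map_smul, shiftSnd_tmul]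
  · refine ext_basis_three (v := v) fun a b c => ?_
    simp only [hR, hR', Module.End.mul_apply]
    exact H.yangBaxter (fun a b c => v a ⊗ₜ[ℂ] (v b ⊗ₜ[ℂ] v c))
      (fun a b c => by rw [shiftTrd_tmul, op12_weightOp])
      (fun a b c => by rw [shiftFst_tmul, op23_weightOp])
      (fun a b c => by rw [shiftSnd_tmul, op13_weightOp hp])
      (op12_weightOp _ _) (op23_weightOp _ _) (op13_weightOp hp _ _) a b c

end Quantum

/-! ### The classical dynamical Yang–Baxter equation in a weight basis. -/

section Classical

open Filter

variable {𝔥 V : Type*} [AddCommGroup 𝔥] [Module ℂ 𝔥] [FiniteDimensional ℂ 𝔥]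
  [AddCommGroup V] [Module ℂ V] {ι : Type*} [Fintype ι] [DecidableEq ι]
  {v : Module.Basis ι ℂ V} {ω : Module.Basis ι ℂ (Module.Dual ℂ 𝔥)}
  {r : Module.Dual ℂ 𝔥 → Module.End ℂ (V ⊗[ℂ] V)} {Ω : Set (ι → ℂ)} (hΩ : IsOpen Ω)
  {A B : ι → ι → (ι → ℂ) → ℂ} (hA : ∀ a b, DifferentiableOn ℂ (A a b) Ω)
  (hB : ∀ a b, DifferentiableOn ℂ (B a b) Ω)
  (hr : ∀ y ∈ Ω, r (ω.equivFun.symm y) = weightOp v (fun a b => A a b y) fun a b => B a b y)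
  {y : ι → ℂ} (hy : y ∈ Ω)

include hΩ hA hB hr hy in
omit [DecidableEq ι] [FiniteDimensional ℂ 𝔥] in
theorem eq_weightOp_of_hasDirDeriv {D : Module.End ℂ (V ⊗[ℂ] V)} {ξ : Module.Dual ℂ 𝔥}
    (hD : HasDirDeriv r D ξ (ω.equivFun.symm y)) :
    D = weightOp v (fun a b => fderiv ℂ (A a b) y (ω.equivFun ξ))
      fun a b => fderiv ℂ (B a b) y (ω.equivFun ξ) := by
  refine ext_basis_two (v := v) fun a b => ?_
  rw [← sub_eq_zero, ← Module.forall_dual_apply_eq_zero_iff ℂ]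
  intro ℓ
  rw [map_sub, sub_eq_zero]
  have h1 := hD (ℓ ∘ₗ LinearMap.applyₗ (v a ⊗ₜ[ℂ] v b))
  have hline : HasDerivAt (fun t : ℂ => y + t • ω.equivFun ξ) (ω.equivFun ξ) 0 := by
    simpa using ((hasDerivAt_id (0 : ℂ)).smul_const (ω.equivFun ξ)).const_add y
  have hcomp : ∀ f : (ι → ℂ) → ℂ, DifferentiableOn ℂ f Ω → HasDerivAt
      (fun t : ℂ => f (y + t • ω.equivFun ξ)) (fderiv ℂ f y (ω.equivFun ξ)) 0 := by
    intro f hf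
    have h2 : HasFDerivAt f (fderiv ℂ f y) (y + (0 : ℂ) • ω.equivFun ξ) := by
      simpa using (hf.differentiableAt (hΩ.mem_nhds hy)).hasFDerivAt
    exact h2.comp_hasDerivAt (0 : ℂ) hline
  have h2 := ((hcomp _ (hA a b)).mul_const (ℓ (v a ⊗ₜ v b))).add
    ((hcomp _ (hB a b)).mul_const (ℓ (v b ⊗ₜ v a)))
  have hev : (fun t : ℂ => (ℓ ∘ₗ LinearMap.applyₗ (v a ⊗ₜ[ℂ] v b))
      (r (ω.equivFun.symm y + t • ξ))) =ᶠ[nhds 0] (fun t : ℂ => A a b (y + t • ω.equivFun ξ)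
        * ℓ (v a ⊗ₜ v b)) + fun t => B a b (y + t • ω.equivFun ξ) * ℓ (v b ⊗ₜ v a) := by
    have : ∀ᶠ t : ℂ in nhds 0, y + t • ω.equivFun ξ ∈ Ω :=
      hline.continuousAt.eventually_mem (hΩ.mem_nhds (by simpa using hy))
    filter_upwards [this] with t ht
    have : ω.equivFun.symm y + t • ξ = ω.equivFun.symm (y + t • ω.equivFun ξ) := by
      rw [map_add, map_smul, LinearEquiv.symm_apply_apply]
    rw [this, LinearMap.comp_apply, LinearMap.applyₗ_apply_apply, hr _ ht, weightOp_tmul]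
    simp
  have := (h1.congr_of_eventuallyEq hev.symm).unique h2
  rw [weightOp_tmul]
  simpa using this

variable {ρ : 𝔥 →ₗ[ℂ] Module.End ℂ V} {𝒱 : ZMod 2 → Submodule ℂ V} [DirectSum.Decomposition 𝒱]
  {p : ι → ZMod 2} (hv : ∀ h a, ρ h (v a) = ω a h • v a) (hp : ∀ a, v a ∈ 𝒱 (p a))
  (hc : CDYBE 𝒱 ρ r (ω.equivFun.symm y))

include hΩ hA hB hr hy hv hp hc in
-- The equation is kept as a vector identity because the six basis vectors merge when indices
-- coincide; the lemmas after it read off single coordinates.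
theorem cdybe_basis (a b c : ι) :
    let s := basisSign p
    let e := fun a b c => v a ⊗ₜ[ℂ] (v b ⊗ₜ[ℂ] v c)
    let d := fun (f : (ι → ℂ) → ℂ) (a : ι) => fderiv ℂ f y (Pi.single a 1)
    (d (A b c) a + d (A a b) c + d (A c a) b) • e a b c
      + d (B b c) a • e a c b + d (B a b) c • e b a c + (s a b * s b c * d (B c a) b) • e c b a
      + (s a b * s b c * B a c y * B c b y - B a b y * B a c y + s a c * s b c * B b c y * B a b y)
        • e b c a
      + (B b c y * B a c y - s a b * s a c * B a b y * B b c y - s a b * s b c * B a c y * B b a y)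
        • e c a b
      + (s a b * s b c * B a c y * (A c b y - A b a y + A b c y - A a b y)) • e c b a = 0 := by
  obtain ⟨D, hD, heq⟩ := hc
  set x := Module.finBasis ℂ 𝔥
  have hM : ∀ a b c, (∑ i, TensorProduct.map (ρ (x i)) (D i)) (v a ⊗ₜ[ℂ] (v b ⊗ₜ[ℂ] v c))
      = fderiv ℂ (A b c) y (Pi.single a 1) • v a ⊗ₜ[ℂ] (v b ⊗ₜ[ℂ] v c)
        + fderiv ℂ (B b c) y (Pi.single a 1) • v a ⊗ₜ[ℂ] (v c ⊗ₜ[ℂ] v b) := by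
    intro a b c
    -- Since `∑ i, ω a (x i) • x_i^* = ω a`, the first factor of `dr` acting on `v a` turns `dr`
    -- into the derivative along the `a`-th coordinate.
    have hsum : ∀ f : (ι → ℂ) → ℂ, fderiv ℂ f y (Pi.single a 1)
        = ∑ i, ω a (x i) * fderiv ℂ f y (ω.equivFun (x.dualBasis i)) := by
      intro f
      have : Pi.single a 1 = ω.equivFun (∑ i, ω a (x i) • x.dualBasis i) := by
        simp only [Module.Basis.coe_dualBasis]
        rw [Module.Basis.sum_dual_apply_smul_coord]
        ext b; simp [Pi.single_apply, eq_comm]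
      rw [this, map_sum, map_sum]
      simp
    simp only [LinearMap.sum_apply, TensorProduct.map_tmul, hv,
      eq_weightOp_of_hasDirDeriv hΩ hA hB hr hy (hD _), weightOp_tmul, hsum, Finset.sum_smul,
      ← Finset.sum_add_distrib, TensorProduct.tmul_add, TensorProduct.tmul_smul,
      ← TensorProduct.smul_tmul', smul_smul]
    simp only [mul_comm]
  have h := LinearMap.congr_fun heq (v a ⊗ₜ[ℂ] (v b ⊗ₜ[ℂ] v c))
  rw [hr y hy] at h
  simp only [altOp, Ring.lie_def, LinearMap.add_apply, LinearMap.sub_apply, Module.End.mul_apply,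
    op12_superTwist hp, op23_superTwist hp, op12_weightOp, op23_weightOp, op13_weightOp hp, hM,
    map_add, map_smul, smul_add, smul_smul, LinearMap.zero_apply, basisSign_comm p b a,
    basisSign_comm p c b, basisSign_comm p c a] at h
  have hab := basisSign_mul_self p a b
  have hbc := basisSign_mul_self p b c
  have hac := basisSign_mul_self p a c
  linear_combination (norm := module) h
    - (fderiv ℂ (A a b) y (Pi.single c 1) * (hbc * basisSign p a c ^ 2 + hac)
      + fderiv ℂ (A c a) y (Pi.single b 1) * (hab * basisSign p a c ^ 2 + hac))
        • v a ⊗ₜ[ℂ] (v b ⊗ₜ[ℂ] v c)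
    - (fderiv ℂ (B a b) y (Pi.single c 1) * (hbc * basisSign p a c ^ 2 + hac))
        • v b ⊗ₜ[ℂ] (v a ⊗ₜ[ℂ] v c)
    - (basisSign p a b * basisSign p b c * fderiv ℂ (B c a) y (Pi.single b 1) * hac)
        • v c ⊗ₜ[ℂ] (v b ⊗ₜ[ℂ] v a)

omit [Fintype ι] in
theorem repr_tmul_three (a b c i j k : ι) :
    (v.tensorProduct (v.tensorProduct v)).repr (v a ⊗ₜ[ℂ] (v b ⊗ₜ[ℂ] v c)) (i, (j, k))
      = if a = i ∧ b = j ∧ c = k then 1 else 0 := by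
  simp only [Module.Basis.tensorProduct_repr_tmul_apply, Module.Basis.repr_self,
    Finsupp.single_apply, smul_eq_mul]
  grind

variable (hBanti : ∀ a b, B b a y = -B a b y)

include hΩ hA hB hr hy hv hp hc

theorem fderiv_closed_of_cdybe {a b c : ι} (hab : a ≠ b) (hbc : b ≠ c) (hac : a ≠ c) :
    fderiv ℂ (A b c) y (Pi.single a 1) + fderiv ℂ (A c a) y (Pi.single b 1)
      + fderiv ℂ (A a b) y (Pi.single c 1) = 0 := by
  have h := congrArg (fun t => (v.tensorProduct (v.tensorProduct v)).repr t (a, (b, c)))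
    (cdybe_basis hΩ hA hB hr hy hv hp hc a b c)
  simp [-Module.Basis.tensorProduct_repr_tmul_apply, repr_tmul_three, hab, hbc, hac, hab.symm,
    hbc.symm, hac.symm] at h
  linear_combination h

theorem fderiv_eq_zero_of_cdybe {a b c : ι} (hab : a ≠ b) (hca : c ≠ a) (hcb : c ≠ b) :
    fderiv ℂ (B a b) y (Pi.single c 1) = 0 := by
  have h := congrArg (fun t => (v.tensorProduct (v.tensorProduct v)).repr t (b, (a, c)))
    (cdybe_basis hΩ hA hB hr hy hv hp hc a b c)
  simpa [-Module.Basis.tensorProduct_repr_tmul_apply, repr_tmul_three, hab, hca, hcb, hab.symm,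
    hca.symm, hcb.symm] using h

theorem triangle_of_cdybe {a b c : ι} (hab : a ≠ b) (hbc : b ≠ c) (hac : a ≠ c) :
    basisSign p a b * basisSign p b c * B a c y * B c b y - B a b y * B a c y
      + basisSign p a c * basisSign p b c * B b c y * B a b y = 0 := by
  have h := congrArg (fun t => (v.tensorProduct (v.tensorProduct v)).repr t (b, (c, a)))
    (cdybe_basis hΩ hA hB hr hy hv hp hc a b c)
  simpa [-Module.Basis.tensorProduct_repr_tmul_apply, repr_tmul_three, hab, hbc, hac, hab.symm,
    hbc.symm, hac.symm] using h

-- On `v_a ⊗ v_a ⊗ v_b` the derivative term and one product from the brackets meet at `v_a ⊗ v_b ⊗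
-- v_a`.
include hBanti in
theorem riccati_of_cdybe {a b : ι} (hab : a ≠ b) : fderiv ℂ (B a b) y (Pi.single a 1)
    = basisSign p a a * basisSign p a b * B a b y ^ 2 := by
  have h := congrArg (fun t => (v.tensorProduct (v.tensorProduct v)).repr t (a, (b, a)))
    (cdybe_basis hΩ hA hB hr hy hv hp hc a a b)
  have h0 : B a a y = 0 := by linear_combination (hBanti a a) / 2
  simp [-Module.Basis.tensorProduct_repr_tmul_apply, repr_tmul_three, hab, hab.symm, h0] at h
  rw [hBanti a b] at h
  linear_combination h

end Classical

/-! ### The diagonal coefficient of the quantization. -/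

section DiagonalCoefficient

variable {ι : Type*} [DecidableEq ι]

/-- The diagonal coefficient `α_ab` of the quantization at `(y, γ)`: the factor `1 + γ β_ab` times
the exponential of the finite-difference analogue of `-dξ`. -/
noncomputable def diagCoeff (β : ι → ι → (ι → ℂ) → ℂ) (ξ : ι → (ι → ℂ) → ℂ) (a b : ι)
    (q : (ι → ℂ) × ℂ) : ℂ :=
  (1 + q.2 * β a b q.1) * Complex.exp (-(ξ b q.1 - ξ b (q.1 - q.2 • Pi.single a 1)
    - ξ a q.1 + ξ a (q.1 - q.2 • Pi.single b 1)))

variable {β : ι → ι → (ι → ℂ) → ℂ} {ξ : ι → (ι → ℂ) → ℂ}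

theorem diagCoeff_zero (a b : ι) (y : ι → ℂ) : diagCoeff β ξ a b (y, 0) = 1 := by
  simp [diagCoeff]

theorem diagCoeff_self {a : ι} {y : ι → ℂ} (h : β a a y = 0) (γ : ℂ) :
    diagCoeff β ξ a a (y, γ) = 1 := by
  simp [diagCoeff, h]

/-- The exponent is antisymmetric in `a, b`, which leaves `(1 + γβ)(1 - γβ)`. -/
theorem diagCoeff_mul_swap {a b : ι} {y : ι → ℂ} (h : β b a y = -β a b y) (γ : ℂ) :
    diagCoeff β ξ a b (y, γ) * diagCoeff β ξ b a (y, γ) = 1 - γ ^ 2 * β a b y ^ 2 := by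
  simp only [diagCoeff, h]
  rw [mul_mul_mul_comm, ← Complex.exp_add]
  have : ∀ s t u w : ℂ, -(s - t - u + w) + -(u - w - s + t) = 0 := fun s t u w => by ring
  rw [this, Complex.exp_zero]
  ring

/-- The prefactors are unaffected by the third shift, and the exponent is a discrete coboundary,
closed because translations commute. The cancellation is formal, so no point has to lie in a domain
of `ξ`. -/
theorem diagCoeff_cocycle {a b c : ι} {y : ι → ℂ} {γ : ℂ}
    (ha : β b c (y - γ • Pi.single a 1) = β b c y) (hb : β a c (y - γ • Pi.single b 1) = β a c y)
    (hc : β a b (y - γ • Pi.single c 1) = β a b y) :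
    diagCoeff β ξ b c (y - γ • Pi.single a 1, γ) * diagCoeff β ξ a c (y, γ)
        * diagCoeff β ξ a b (y - γ • Pi.single c 1, γ)
      = diagCoeff β ξ a b (y, γ) * diagCoeff β ξ a c (y - γ • Pi.single b 1, γ)
        * diagCoeff β ξ b c (y, γ) := by
  simp only [diagCoeff, ha, hb, hc]
  have h : ∀ p q r l m k : ℂ, p * Complex.exp l * (q * Complex.exp m) * (r * Complex.exp k)
      = p * q * r * Complex.exp (l + m + k) := by
    intro p q r l m k; rw [Complex.exp_add, Complex.exp_add]; ring
  rw [h, h, sub_right_comm y (γ • Pi.single b 1) (γ • Pi.single a 1),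
    sub_right_comm y (γ • Pi.single c 1) (γ • Pi.single a 1),
    sub_right_comm y (γ • Pi.single c 1) (γ • Pi.single b 1)]
  congr 1
  · ring
  · congr 1; ring

variable [Fintype ι] {Ω : Set (ι → ℂ)} (hΩ : IsOpen Ω) (hβ : ∀ a b, DifferentiableOn ℂ (β a b) Ω)
  (hξ : ∀ a, DifferentiableOn ℂ (ξ a) Ω)

/-- The pairs `(y, γ)` such that `y` and its translates by `-γ e_a` lie in `Ω`. -/
def shiftDomain (Ω : Set (ι → ℂ)) : Set ((ι → ℂ) × ℂ) :=
  {q | q.1 ∈ Ω ∧ ∀ a, q.1 - q.2 • Pi.single a 1 ∈ Ω}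

include hΩ in
theorem isOpen_shiftDomain : IsOpen (shiftDomain Ω) := by
  have : shiftDomain Ω = Prod.fst ⁻¹' Ω ∩
      ⋂ a, (fun q : (ι → ℂ) × ℂ => q.1 - q.2 • Pi.single a 1) ⁻¹' Ω := by
    ext q; simp [shiftDomain]
  rw [this]
  exact (hΩ.preimage continuous_fst).inter
    (isOpen_iInter_of_finite fun a => hΩ.preimage (by fun_prop))

include hβ hξ in
theorem differentiableOn_diagCoeff (a b : ι) :
    DifferentiableOn ℂ (diagCoeff β ξ a b) (shiftDomain Ω) := by
  have h1 : ∀ {f : (ι → ℂ) → ℂ}, DifferentiableOn ℂ f Ω →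
      DifferentiableOn ℂ (fun q : (ι → ℂ) × ℂ => f q.1) (shiftDomain Ω) := fun hf =>
    hf.comp (by fun_prop) fun q hq => hq.1
  have h2 : ∀ {f : (ι → ℂ) → ℂ} (c : ι), DifferentiableOn ℂ f Ω → DifferentiableOn ℂ
      (fun q : (ι → ℂ) × ℂ => f (q.1 - q.2 • Pi.single c 1)) (shiftDomain Ω) := fun c hf =>
    hf.comp (by fun_prop) fun q hq => hq.2 c
  exact ((differentiableOn_const _).add (differentiableOn_snd.mul (h1 (hβ a b)))).mul
    ((((h1 (hξ b)).sub (h2 a (hξ b))).sub (h1 (hξ a))).add (h2 b (hξ a))).neg.cexp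

-- When `dξ = A + β`, this derivative is `-A_ab`, the diagonal coefficient of `-r`.
include hΩ hξ in
theorem hasDerivAt_diagCoeff {y : ι → ℂ} (hy : y ∈ Ω) (a b : ι) :
    HasDerivAt (fun γ => diagCoeff β ξ a b (y, γ)) (β a b y
      - (fderiv ℂ (ξ b) y (Pi.single a 1) - fderiv ℂ (ξ a) y (Pi.single b 1))) 0 := by
  have h : ∀ a b, HasDerivAt (fun γ : ℂ => ξ b (y - γ • Pi.single a 1))
      (-fderiv ℂ (ξ b) y (Pi.single a 1)) 0 := by
    intro a b
    have h1 : HasFDerivAt (ξ b) (fderiv ℂ (ξ b) y) (y - (0 : ℂ) • Pi.single a 1) := by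
      simpa using ((hξ b).differentiableAt (hΩ.mem_nhds hy)).hasFDerivAt
    have h2 : HasDerivAt (fun γ : ℂ => y - γ • (Pi.single a 1 : ι → ℂ)) (-Pi.single a 1) 0 := by
      simpa using ((hasDerivAt_id (0 : ℂ)).smul_const (Pi.single a 1 : ι → ℂ)).const_sub y
    convert! h1.comp_hasDerivAt (0 : ℂ) h2 using 1
    simp
  have h3 : HasDerivAt (fun γ : ℂ => 1 + γ * β a b y) (β a b y) 0 := by
    simpa using ((hasDerivAt_id (0 : ℂ)).mul_const (β a b y)).const_add 1
  have h4 := h3.mul ((((h a b).const_sub (ξ b y)).sub_const (ξ a y)).add (h b a)).neg.cexp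
  convert! h4 using 1
  simp
  ring

end DiagonalCoefficient

/-! ### Quantum relations, invertibility and antisymmetry. -/

section Quantization

variable {ι : Type*} [Fintype ι] [DecidableEq ι]

theorem quantumRelations_diagCoeff {p : ι → ZMod 2} {β : ι → ι → (ι → ℂ) → ℂ}
    {ξ : ι → (ι → ℂ) → ℂ} {Ω : Set (ι → ℂ)} (hΩ : IsOpen Ω) (hconv : Convex ℝ Ω)
    (hβ : ∀ a b, DifferentiableOn ℂ (β a b) Ω)
    (hanti : ∀ a b, ∀ y ∈ Ω, β b a y = -β a b y)
    (hconst : ∀ a b c, c ≠ a → c ≠ b → ∀ y ∈ Ω, fderiv ℂ (β a b) y (Pi.single c 1) = 0)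
    (hric : ∀ a b, a ≠ b → ∀ y ∈ Ω,
      fderiv ℂ (β a b) y (Pi.single a 1) = basisSign p a a * β a b y ^ 2)
    (htri : ∀ a b c, a ≠ b → b ≠ c → a ≠ c → ∀ y ∈ Ω,
      β a b y * β b c y = β a c y * (β a b y + β b c y))
    {y : ι → ℂ} {γ : ℂ} (hy : y ∈ Ω) (hyγ : ∀ c, y - γ • Pi.single c 1 ∈ Ω) :
    QuantumRelations (basisSign p) γ (fun a b => diagCoeff β ξ a b (y, γ)) (fun a b => β a b y)
      (fun c a b => diagCoeff β ξ a b (y - γ • Pi.single c 1, γ))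
      (fun c a b => β a b (y - γ • Pi.single c 1)) := by
  have h0 : ∀ a, ∀ y ∈ Ω, β a a y = 0 := fun a y hy => by
    linear_combination hanti a a y hy / 2
  have hshift : ∀ a b c, c ≠ a → c ≠ b → β a b (y - γ • Pi.single c 1) = β a b y := by
    intro a b c hca hcb
    -- The case `κ = 0` of the Riccati shift: constancy along the third coordinate.
    simpa using riccati_shift hΩ hconv (hβ a b) (κ := 0)
      (fun y hy => by rw [hconst a b c hca hcb y hy, zero_mul]) hy (hyγ c)
  exact
  { comm := basisSign_comm p
    sq := basisSign_mul_self p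
    anti := fun a b => hanti a b y hy
    anti' := fun c a b => hanti a b _ (hyγ c)
    diag := fun a => diagCoeff_self (h0 a y hy) γ
    diag' := fun c a => diagCoeff_self (h0 a _ (hyγ c)) γ
    det := fun a b => diagCoeff_mul_swap (hanti a b y hy) γ
    det' := fun c a b => diagCoeff_mul_swap (hanti a b _ (hyγ c)) γ
    shift := hshift
    riccati := fun a b hab => riccati_shift hΩ hconv (hβ a b) (hric a b hab) hy (hyγ a)
    triangle := fun a b c hab hbc hac => htri a b c hab hbc hac y hy
    closed := fun a b c hab hbc hac => diagCoeff_cocycle (hshift b c a hab hac)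
      (hshift a c b hab.symm hbc) (hshift a b c hac.symm hbc.symm) }

variable {V : Type*} [AddCommGroup V] [Module ℂ V] (v : Module.Basis ι ℂ V)

/-- Linearity in the coefficients reduces holomorphy and summation of operators to scalars. -/
theorem exists_weightOp_eq_sum : ∃ P Q : ι → ι → Module.End ℂ (V ⊗[ℂ] V), ∀ α β : ι → ι → ℂ,
    weightOp v α β = ∑ a, ∑ b, (α a b • P a b + β a b • Q a b) := by
  refine ⟨fun a b => weightOp v (fun c d => if a = c ∧ b = d then 1 else 0) 0,
    fun a b => weightOp v 0 (fun c d => if a = c ∧ b = d then 1 else 0), fun α β => ?_⟩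
  refine ext_basis_two (v := v) fun c d => ?_
  simp [LinearMap.sum_apply, weightOp_tmul, Finset.sum_add_distrib, ite_and]

-- Unitarity: the inverse has the same coefficients with the two indices exchanged.
omit [Fintype ι] [DecidableEq ι] in
theorem isUnit_weightOp {α β : ι → ι → ℂ} (hdiag : ∀ a b, α a b * α b a + β a b ^ 2 = 1)
    (hanti : ∀ a b, β b a = -β a b) : IsUnit (weightOp v α β) := by
  have h : ∀ {α β : ι → ι → ℂ}, (∀ a b, α a b * α b a + β a b ^ 2 = 1) →
      (∀ a b, β b a = -β a b) →
      weightOp v α β * weightOp v (fun a b => α b a) (fun a b => β b a) = 1 := by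
    intro α β hdiag hanti
    refine ext_basis_two (v := v) fun a b => ?_
    simp only [Module.End.mul_apply, weightOp_tmul, map_add, map_smul, Module.End.one_apply,
      hanti a b]
    linear_combination (norm := module) hdiag a b • v a ⊗ₜ[ℂ] v b
  refine isUnit_iff_exists.2 ⟨_, h hdiag hanti, ?_⟩
  exact h (fun a b => by rw [hanti a b]; linear_combination hdiag a b)
    (fun a b => hanti b a)

omit [Fintype ι] [DecidableEq ι] in
theorem weightOp_one_zero : weightOp v (fun _ _ => 1) (fun _ _ => 0) = 1 :=
  ext_basis_two (v := v) fun a b => by simp [weightOp_tmul]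

omit [Fintype ι] [DecidableEq ι] in
theorem neg_weightOp (α β : ι → ι → ℂ) :
    -weightOp v α β = weightOp v (fun a b => -α a b) fun a b => -β a b :=
  ext_basis_two (v := v) fun a b => by
    rw [LinearMap.neg_apply, weightOp_tmul, weightOp_tmul]; module

variable {v}

-- The vanishing of `β a a` is what separates the two coefficients at `a = b`.
omit [Fintype ι] in
theorem antisymm_of_unitarity {𝒱 : ZMod 2 → Submodule ℂ V} [DirectSum.Decomposition 𝒱]
    {p : ι → ZMod 2} (hp : ∀ a, v a ∈ 𝒱 (p a)) {α β : ι → ι → ℂ} (hβ : ∀ a, β a a = 0)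
    (h : weightOp v α β + twistOp 𝒱 (weightOp v α β) = 0) :
    (∀ a b, α b a = -α a b) ∧ ∀ a b, β b a = -β a b := by
  rw [twistOp_weightOp hp] at h
  have key : ∀ a b c d, (v.tensorProduct v).repr ((weightOp v α β
      + weightOp v (fun a b => α b a) fun a b => β b a) (v a ⊗ₜ v b)) (c, d) = 0 := by
    intro a b c d; rw [h]; simp
  simp only [LinearMap.add_apply, weightOp_tmul, map_add, map_smul, Finsupp.add_apply,
    Finsupp.smul_apply, Module.Basis.tensorProduct_repr_tmul_apply, Module.Basis.repr_self,
    Finsupp.single_apply, smul_eq_mul] at key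
  refine ⟨fun a b => ?_, fun a b => ?_⟩
  · have := key a b a b
    grind
  · have := key a b b a
    grind

end Quantization

/-! ### Polydiscs and changes of linear coordinates. -/

section Polydisc

variable {E : Type*} [AddCommGroup E] [Module ℂ E] {n : ℕ}

theorem IsOpenPolydisc.preimage {U : Set E} (hU : IsOpenPolydisc U) (φ : (Fin n → ℂ) ≃ₗ[ℂ] E) :
    IsOpen (φ ⁻¹' U) ∧ Convex ℝ (φ ⁻¹' U) ∧ (φ ⁻¹' U).Nonempty := by
  obtain ⟨m, e, c, R, hR, rfl⟩ := hU
  let L : Fin m → (Fin n → ℂ) →ₗ[ℂ] ℂ := fun i => e.coord i ∘ₗ φ.toLinearMap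
  have hpre : φ ⁻¹' {z | ∀ i, ‖e.repr (z - c) i‖ < R i}
      = ⋂ i, L i ⁻¹' Metric.ball (e.repr c i) (R i) := by
    ext y; simp [L, dist_eq_norm]
  refine ⟨?_, ?_, φ.symm c, by simpa using hR⟩
  · rw [hpre]
    exact isOpen_iInter_of_finite fun i =>
      Metric.isOpen_ball.preimage (L i).continuous_of_finiteDimensional
  · rw [hpre]
    exact convex_iInter fun i => (convex_ball _ _).linear_preimage ((L i).restrictScalars ℝ)

theorem isHolomorphicOn_of_coord {W : Type*} [AddCommGroup W] [Module ℂ W] {f : E → W} {U : Set E}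
    (φ : (Fin n → ℂ) ≃ₗ[ℂ] E)
    (h : ∀ ℓ : Module.Dual ℂ W, DifferentiableOn ℂ (fun y => ℓ (f (φ y))) (φ ⁻¹' U)) :
    IsHolomorphicOn f U := by
  intro ℓ m ψ
  let L : (Fin m → ℂ) →L[ℂ] (Fin n → ℂ) := (ψ.trans φ.symm).toLinearMap.toContinuousLinearMap
  have hL : ∀ z, φ (L z) = ψ z := fun z => by simp [L]
  have := (h ℓ).comp L.differentiable.differentiableOn (s := ψ ⁻¹' U)
    fun z hz => by simpa [hL] using hz
  simpa [Function.comp_def, hL] using this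

variable (ω : Module.Basis (Fin n) ℂ E)

theorem mem_polydisc_iff {z₀ z : E} {δ : ℝ} (hδ : 0 < δ) :
    (∀ i, ‖ω.repr (z - z₀) i‖ < δ) ↔ ω.equivFun z ∈ Metric.ball (ω.equivFun z₀) δ := by
  rw [Metric.mem_ball, dist_pi_lt_iff hδ]
  simp [dist_eq_norm]

end Polydisc

/-! ### Reduction of the `r`-matrix to scalar equations. -/

section Main

variable {𝔥 V : Type*} [AddCommGroup 𝔥] [Module ℂ 𝔥] [FiniteDimensional ℂ 𝔥]
  [AddCommGroup V] [Module ℂ V] {n : ℕ} {v : Module.Basis (Fin n) ℂ V}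
  {ω : Module.Basis (Fin n) ℂ (Module.Dual ℂ 𝔥)}
  {ρ : 𝔥 →ₗ[ℂ] Module.End ℂ V} {𝒱 : ZMod 2 → Submodule ℂ V} [DirectSum.Decomposition 𝒱]
  {p : Fin n → ZMod 2} {U : Set (Module.Dual ℂ 𝔥)}
  {r : Module.Dual ℂ 𝔥 → Module.End ℂ (V ⊗[ℂ] V)}

/-- The coefficients of a zero weight `r`-matrix, in the coordinates given by a weight basis. -/
theorem exists_classical_coefficients (hv : ∀ h a, ρ h (v a) = ω a h • v a)
    (hp : ∀ a, v a ∈ 𝒱 (p a)) (hU : IsOpenPolydisc U) (hol : IsHolomorphicOn r U)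
    (hr : IsZeroWeightZeroCouplingRMatrix 𝒱 ρ U r) :
    ∃ A β : Fin n → Fin n → (Fin n → ℂ) → ℂ,
      (∀ y ∈ ω.equivFun.symm ⁻¹' U, r (ω.equivFun.symm y)
        = weightOp v (fun a b => A a b y) fun a b => basisSign p a b * β a b y) ∧
      (∀ a b, DifferentiableOn ℂ (A a b) (ω.equivFun.symm ⁻¹' U)) ∧
      (∀ a b, DifferentiableOn ℂ (β a b) (ω.equivFun.symm ⁻¹' U)) ∧
      (∀ a b, ∀ y ∈ ω.equivFun.symm ⁻¹' U, A b a y = -A a b y) ∧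
      (∀ a b, ∀ y ∈ ω.equivFun.symm ⁻¹' U, β b a y = -β a b y) ∧
      (∀ a b c, a ≠ b → b ≠ c → a ≠ c → ∀ y ∈ ω.equivFun.symm ⁻¹' U,
        fderiv ℂ (A b c) y (Pi.single a 1) + fderiv ℂ (A c a) y (Pi.single b 1)
          + fderiv ℂ (A a b) y (Pi.single c 1) = 0) ∧
      (∀ a b c, c ≠ a → c ≠ b → ∀ y ∈ ω.equivFun.symm ⁻¹' U,
        fderiv ℂ (β a b) y (Pi.single c 1) = 0) ∧
      (∀ a b, a ≠ b → ∀ y ∈ ω.equivFun.symm ⁻¹' U,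
        fderiv ℂ (β a b) y (Pi.single a 1) = basisSign p a a * β a b y ^ 2) ∧
      ∀ a b c, a ≠ b → b ≠ c → a ≠ c → ∀ y ∈ ω.equivFun.symm ⁻¹' U,
        β a b y * β b c y = β a c y * (β a b y + β b c y) := by
  set φ := ω.equivFun.symm with hφ
  have hΩ := (hU.preimage φ).1
  let co : Fin n → Fin n → Fin n → Fin n → Module.Dual ℂ (Module.End ℂ (V ⊗[ℂ] V)) :=
    fun a b c d => (v.tensorProduct v).coord (c, d) ∘ₗ LinearMap.applyₗ (v a ⊗ₜ[ℂ] v b)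
  let A : Fin n → Fin n → (Fin n → ℂ) → ℂ := fun a b y => co a b a b (r (φ y))
  let B : Fin n → Fin n → (Fin n → ℂ) → ℂ := fun a b y =>
    if a = b then 0 else co a b b a (r (φ y))
  have hrB : ∀ y ∈ φ ⁻¹' U, r (φ y) = weightOp v (fun a b => A a b y) fun a b => B a b y :=
    fun y hy => eq_weightOp_of_hasZeroWeight hv (hr.zeroWeight _ hy)
  have hA : ∀ a b, DifferentiableOn ℂ (A a b) (φ ⁻¹' U) := fun a b => hol (co a b a b) n φ
  have hB : ∀ a b, DifferentiableOn ℂ (B a b) (φ ⁻¹' U) := by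
    intro a b
    by_cases hab : a = b
    · simp only [B, hab, if_true]; exact differentiableOn_const _
    · simp only [B, hab, if_false]; exact hol (co a b b a) n φ
  have hanti := fun y (hy : y ∈ φ ⁻¹' U) => antisymm_of_unitarity hp (α := fun a b => A a b y)
    (β := fun a b => B a b y) (fun a => by simp [B])
    (by rw [← hrB y hy]; exact hr.unitarity _ hy)
  have hsB : ∀ a b y w, y ∈ φ ⁻¹' U → fderiv ℂ (fun y => basisSign p a b * B a b y) y w
      = basisSign p a b * fderiv ℂ (B a b) y w := by
    intro a b y w hy
    rw [fderiv_const_mul ((hB a b).differentiableAt (hΩ.mem_nhds hy))]; rfl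
  refine ⟨A, fun a b y => basisSign p a b * B a b y, fun y hy => ?_, hA,
    fun a b => (hB a b).const_mul _, fun a b y hy => (hanti y hy).1 a b, fun a b y hy => ?_,
    fun a b c hab hbc hac y hy => ?_, fun a b c hca hcb y hy => ?_, fun a b hab y hy => ?_,
    fun a b c hab hbc hac y hy => ?_⟩
  · simp only [← mul_assoc, basisSign_mul_self, one_mul]
    exact hrB y hy
  · simp only [(hanti y hy).2 a b, basisSign_comm p b a, mul_neg]
  · exact fderiv_closed_of_cdybe hΩ hA hB hrB hy hv hp (hr.cdybe _ hy) hab hbc hac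
  · rw [hsB a b y _ hy]
    by_cases hab : a = b
    · have : B a b = fun _ => 0 := by funext z; simp [B, hab]
      simp [this]
    · rw [fderiv_eq_zero_of_cdybe hΩ hA hB hrB hy hv hp (hr.cdybe _ hy) hab hca hcb, mul_zero]
  · rw [hsB a b y _ hy, riccati_of_cdybe hΩ hA hB hrB hy hv hp (hr.cdybe _ hy)
      (hanti y hy).2 hab]
    ring
  -- Multiplication by `s_ab s_ac` absorbs the signs into `β = s B`.
  · have h := triangle_of_cdybe hΩ hA hB hrB hy hv hp (hr.cdybe _ hy) hab hbc hac
    rw [(hanti y hy).2 b c] at h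
    have h1 := basisSign_mul_self p a b
    have h2 := basisSign_mul_self p a c
    linear_combination basisSign p a b * basisSign p a c * h
      + basisSign p b c * B b c y * (basisSign p a c * B a c y * h1 - basisSign p a b * B a b y * h2)

end Main

end SuperDynamical

/-! ### Assembly of the quantization. -/

theorem theorem1p1 {𝔥 V : Type*}
    [AddCommGroup 𝔥] [Module ℂ 𝔥] [FiniteDimensional ℂ 𝔥]
    [AddCommGroup V] [Module ℂ V] [FiniteDimensional ℂ V]
    (𝒽 : ZMod 2 → Submodule ℂ 𝔥) [DirectSum.Decomposition 𝒽]
    (𝒱 : ZMod 2 → Submodule ℂ V) [DirectSum.Decomposition 𝒱]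
    (ρ : 𝔥 →ₗ[ℂ] Module.End ℂ V)
    (hρ : SuperDynamical.IsModule 𝒽 𝒱 ρ)
    (hss : SuperDynamical.IsSemisimple 𝒱 ρ)
    (hwt : SuperDynamical.WeightsFormBasis ρ)
    (U : Set (Module.Dual ℂ 𝔥)) (hU : SuperDynamical.IsOpenPolydisc U)
    (r : Module.Dual ℂ 𝔥 → Module.End ℂ (V ⊗[ℂ] V))
    (hol : SuperDynamical.IsHolomorphicOn r U)
    (hr : SuperDynamical.IsZeroWeightZeroCouplingRMatrix 𝒱 ρ U r) :
    SuperDynamical.IsQuantizableOn 𝒱 ρ U r := by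
  open SuperDynamical in
  obtain ⟨n, v, ω, p, hp, hv⟩ := exists_homogeneous_weight_basis hρ hwt
  obtain ⟨A, β, hrA, hA, hβ, hAanti, hβanti, hclosed, hconst, hric, htri⟩ :=
    exists_classical_coefficients hv hp hU hol hr
  set φ := ω.equivFun.symm with hφ
  have hφω : ∀ z, φ (ω.equivFun z) = z := fun z => ω.equivFun.symm_apply_apply z
  obtain ⟨hΩ, hconv, y₀, hy₀⟩ := hU.preimage φ
  set Ω := φ ⁻¹' U with hΩU
  have hmem : ∀ z ∈ U, ω.equivFun z ∈ Ω := fun z hz => by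
    rw [hΩU, Set.mem_preimage, hφω]; exact hz
  -- The summand `β` offsets the first-order term of the factor `1 + γ β_ab`.
  obtain ⟨ξ, hξ, hdξ⟩ := exists_potential hΩ hconv hy₀ (A := fun a b y => A a b y + β a b y)
    (fun a b => (hA a b).add (hβ a b))
    (fun a b y hy => by rw [hAanti a b y hy, hβanti a b y hy]; ring)
    (fun a b c hab hbc hac y hy => by
      have hadd : ∀ a b w, fderiv ℂ (fun y => A a b y + β a b y) y w
          = fderiv ℂ (A a b) y w + fderiv ℂ (β a b) y w := fun a b w => by
        rw [fderiv_fun_add ((hA a b).differentiableAt (hΩ.mem_nhds hy))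
          ((hβ a b).differentiableAt (hΩ.mem_nhds hy))]; rfl
      rw [hadd, hadd, hadd, hconst b c a hab hac y hy, hconst c a b hbc hab.symm y hy,
        hconst a b c hac.symm hbc.symm y hy]
      linear_combination hclosed a b c hab hbc hac y hy)
  have hF := fun a b => differentiableOn_diagCoeff hβ hξ a b
  have hW := isOpen_shiftDomain hΩ
  have hW0 : ∀ y ∈ Ω, (y, (0 : ℂ)) ∈ shiftDomain Ω := fun y hy => by simp [shiftDomain, hy]
  -- Taylor coefficients in `γ` at `0`; the flip part `off` lives in degree one only.
  let coef : ℕ → Fin n → Fin n → (Fin n → ℂ) → ℂ := fun k a b y =>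
    (k.factorial : ℂ)⁻¹ * iteratedDeriv k (fun γ => diagCoeff β ξ a b (y, γ)) 0
  let off : ℕ → Fin n → Fin n → (Fin n → ℂ) → ℂ := fun k a b y =>
    if k = 1 then -(basisSign p a b * β a b y) else 0
  have hcoef : ∀ k a b, DifferentiableOn ℂ (coef k a b) Ω := fun k a b =>
    ((differentiableOn_iteratedDeriv_snd hW (hF a b) k).comp (f := fun y => (y, (0 : ℂ)))
      (by fun_prop) hW0).const_mul _
  have hoff : ∀ k a b, DifferentiableOn ℂ (off k a b) Ω := fun k a b => by
    by_cases hk : k = 1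
    · simp only [off, hk, if_true]; exact ((hβ a b).const_mul _).neg
    · simp only [off, hk, if_false]; exact differentiableOn_const _
  obtain ⟨P, Q, hPQ⟩ := exists_weightOp_eq_sum v
  refine ⟨fun k z => weightOp v (fun a b => coef k a b (ω.equivFun z))
      fun a b => off k a b (ω.equivFun z),
    fun γ z => weightOp v (fun a b => diagCoeff β ξ a b (ω.equivFun z, γ))
      fun a b => -(γ * basisSign p a b * β a b (ω.equivFun z)), fun z hz => ?_, fun z hz => ?_,
    fun k => ?_, fun z₀ hz₀ => ?_⟩
  · rw [← weightOp_one_zero v]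
    simp [coef, off, diagCoeff_zero]
  · have hy := hmem z hz
    have := hrA _ hy
    rw [hφω] at this
    rw [this, neg_weightOp]
    refine congrArg₂ (weightOp v) (funext₂ fun a b => ?_) (funext₂ fun a b => by simp [off])
    simp only [coef, iteratedDeriv_one, (hasDerivAt_diagCoeff hΩ hξ hy a b).deriv, hdξ a b _ hy]
    simp
  · refine isHolomorphicOn_of_coord φ fun ℓ => ?_
    simp only [hPQ, map_sum, map_add, map_smul, smul_eq_mul, hφ, LinearEquiv.apply_symm_apply]
    exact DifferentiableOn.fun_sum fun a _ => DifferentiableOn.fun_sum fun b _ =>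
      ((hcoef k a b).mul_const _).add ((hoff k a b).mul_const _)
  · obtain ⟨η, hη, hball⟩ := Metric.isOpen_iff.1 hΩ _ (hmem z₀ hz₀)
    -- Half of the radius is reserved for the shifts, since `‖γ e_a‖ ≤ ‖γ‖ < δ`.
    obtain ⟨δ, hδ, hδη⟩ : ∃ δ : ℝ, 0 < δ ∧ δ + δ = η := ⟨η / 2, half_pos hη, add_halves η⟩
    have hshiftmem : ∀ y ∈ Metric.ball (ω.equivFun z₀) δ, ∀ γ : ℂ, ‖γ‖ < δ →
        (y, γ) ∈ shiftDomain Ω := by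
      intro y hy γ hγ
      rw [Metric.mem_ball, dist_eq_norm] at hy
      refine ⟨hball ?_, fun a => hball ?_⟩ <;> rw [Metric.mem_ball, dist_eq_norm]
      · linarith
      · have h1 : ‖γ • (Pi.single a 1 : Fin n → ℂ)‖ ≤ ‖γ‖ := by
          rw [norm_smul, Pi.norm_single, norm_one, mul_one]
        calc ‖y - γ • Pi.single a 1 - ω.equivFun z₀‖
            = ‖(y - ω.equivFun z₀) - γ • Pi.single a 1‖ := by rw [sub_right_comm]
          _ ≤ _ := norm_sub_le _ _
          _ < η := by linarith
    have hequiv : ∀ (z : Module.Dual ℂ 𝔥) (γ : ℂ) (a : Fin n),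
        ω.equivFun (z - γ • ω a) = ω.equivFun z - γ • Pi.single a 1 := by
      intro z γ a
      rw [map_sub, map_smul]
      congr 2
      ext b; simp [Pi.single_apply, eq_comm]
    refine ⟨{z | ∀ i, ‖ω.repr (z - z₀) i‖ < δ}, ⟨n, ω, z₀, fun _ => δ, fun _ => hδ, rfl⟩,
      fun i => by simpa using hδ, fun z hz => ?_, δ, hδ, fun γ hγ => ⟨fun z hz ℓ => ?_, ?_⟩⟩
    · have := (hshiftmem _ ((mem_polydisc_iff ω hδ).1 hz) 0 (by simpa using hδ)).1
      rwa [hΩU, Set.mem_preimage, hφω] at this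
    · have hz' := (mem_polydisc_iff ω hδ).1 hz
      simp only [hPQ, map_sum, map_add, map_smul, smul_eq_mul, Finset.mul_sum, mul_add,
        ← mul_assoc]
      refine hasSum_sum fun a _ => hasSum_sum fun b _ => HasSum.add (HasSum.mul_right _ ?_)
        (HasSum.mul_right _ ?_)
      · have hd : DifferentiableOn ℂ (fun γ => diagCoeff β ξ a b (ω.equivFun z, γ))
            (Metric.ball 0 δ) :=
          (hF a b).comp (f := fun γ : ℂ => (ω.equivFun z, γ)) (by fun_prop)
            fun γ hγ => hshiftmem _ hz' γ (by simpa using hγ)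
        convert! Complex.hasSum_taylorSeries_on_ball hd (z := γ) (by simpa using hγ) using 2 with k
        simp only [coef, sub_zero, smul_eq_mul]
        ring
      · convert! hasSum_ite_eq 1 (-(γ * basisSign p a b * β a b (ω.equivFun z))) using 2 with k
        by_cases hk : k = 1
        · simp [off, hk]; ring
        · simp [off, hk]
    · have hrel : ∀ z, (∀ i, ‖ω.repr (z - z₀) i‖ < δ) → _ := fun z hz =>
        let hy := hshiftmem _ ((mem_polydisc_iff ω hδ).1 hz) γ hγ
        quantumRelations_diagCoeff (ξ := ξ) hΩ hconv hβ hβanti hconst hric htri hy.1 hy.2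
      refine ⟨fun z hz => ?_, fun z _ => hasZeroWeight_weightOp hv _ _, fun z hz _ => ?_⟩
      · have H := hrel z hz
        refine isUnit_weightOp v (fun a b => ?_) fun a b => ?_
        · linear_combination H.det a b + γ ^ 2 * β a b (ω.equivFun z) ^ 2 * H.sq a b
        · rw [H.anti a b, H.comm b a]; ring
      · refine qdybe_weightOp hv hp (hrel z hz) rfl fun c => ?_
        simp only [hequiv]
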